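/- Let $\xi_1,\xi_2$ be a basis of $\mathbb{R}^2$, let $\Lambda=\mathbb{Z}\xi_1+\mathbb{Z}\xi_2$, and let $n\ge 1$. For $z\in\Lambda$ put $C_{z,0}^n=\{z+\lambda_1\xi_1+\lambda_2\xi_2 : \lambda_1,\lambda_2\in\{0,\dots,n-1\}\}$. For $B\subseteq C_{0,0}^n$ and $k\ge 0$ let $n_B^k$ be the number of sets $S\subseteq\Lambda\setminus\{0\}$ with $|S|=k$ and $B\cap\bigcap_{z\in S}C_{z,0}^n\neq\emptyset$ (with $S=\emptyset$ giving $B\cap\Lambda$), and define the weight $$w_B=\sum_{k=1}^{n^2}(-1)^{k-1}\,\frac1k\,n_B^{k-1}.$$ For $a>0$, $c\in\mathbb{R}^2$ and a bounded set $X\subseteq\mathbb{R}^2$ define the local estimator $$\hat V_0^{n,a\Lambda_c}(X)=\sum_{\emptyset\ne B\subseteq C_{0,0}^n} w_B\cdot\#\{z\in\Lambda : a(z+B+c)\subseteq X,\ a(z+(C_{0,0}^n\setminus B)+c)\cap X=\emptyset\}.$$ Let $\mathcal{K}^2$ be the class of compact convex subsets of $\mathbb{R}^2$ with non-empty interior.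 A point $x\in\partial K$ of $K\in\mathcal K^2$ is called $n$-critical (with respect to $\xi$) if for all $a>0$ $$(K-x)\cap a\,\{\lambda_1\xi_1+\lambda_2\xi_2 : \lambda_1,\lambda_2\in\mathbb{Z},\ -n<\lambda_1,\lambda_2<n\}=\{0\}.$$ The interior angle of $K$ at $x\in\partial K$ is $\sup\{\angle(y-x,z-x) : y,z\in K\setminus\{x\}\}$ (at a vertex of a convex polygon, the usual interior angle). Write $V_0$ for the Euler characteristic (the intrinsic volume of order $0$, given by the Steiner formula $\mathcal{H}^2(K\oplus B(r))=V_2(K)+2rV_1(K)+\pi r^2V_0(K)$, with $B(r)$ the closed ball of radius $r$ about $0$; $V_0(K)=1$ for $K\in\mathcal K^2$). An estimator is called multigrid convergent on a class $\mathcal S$ if $\lim_{a\to0^+}\hat V^{a\Lambda_0}(X)=V_0(X)$ for every $X\in\mathcal S$. Proposition. (i) For every basis $\xi$, every $n\ge1$ and every $K\in\mathcal{K}^2$ without $n$-critical boundary points there is a $\delta>0$ such that $\hat V_0^{n,a\Lambda_c}(K)=1$ for all $0<a<\delta$ and all $c\in\mathbb{R}^2$. (ii) Hence, for every basis $\xi$,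 there are numbers $\psi_n>0$ with $\psi_n<\pi$ for $n\ge2$ and $\lim_{n\to\infty}\psi_n=0$ such that, for every $n\ge1$, $\hat V_0^n$ is multigrid convergent on the class of all $K\in\mathcal K^2$ (in particular, all convex polygons with non-empty interior) whose interior angles at extreme points (for polygons: at vertices) are all at least $\psi_n$. (iii) For $\Lambda=\mathbb{Z}^2$ (with the standard basis) and $n=2$, $\hat V_0^2$ is multigrid convergent on the class of convex polygons with non-empty interior none of whose interior angles is less than $45$ degrees. -/

import Mathlib

open Set Filter Topology MeasureTheory
open scoped Pointwise

noncomputable section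

namespace LocalEuler

/-- The Euclidean plane. -/
abbrev Plane : Type := EuclideanSpace ℝ (Fin 2)

/-- The lattice point `z₁ ξ₁ + z₂ ξ₂`. Since `ξ` is a basis, `ℤ × ℤ` parametrizes the lattice
`Λ` spanned by `ξ` bijectively, and subsets of `Λ` are described below by their coordinates. -/
def latticePoint (ξ : Module.Basis (Fin 2) ℝ Plane) (z : ℤ × ℤ) : Plane :=
  (z.1 : ℝ) • ξ 0 + (z.2 : ℝ) • ξ 1

/-- The set `C_{z,0}^n` of the `n ^ 2` lattice points in the half-open cell
`z + [0, n ξ₁) ⊕ [0, n ξ₂)`. -/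
def cell (n : ℕ) (z : ℤ × ℤ) : Finset (ℤ × ℤ) :=
  Finset.Ico z.1 (z.1 + n) ×ˢ Finset.Ico z.2 (z.2 + n)

/-- The number `n_B^k` of sets `S` of `k` nonzero lattice points such that `B` meets
`⋂ z ∈ S, C_{z,0}^n` (for `S = ∅` the intersection is the whole lattice). -/
def cellCount (n : ℕ) (B : Finset (ℤ × ℤ)) (k : ℕ) : ℕ :=
  Set.ncard {S : Finset (ℤ × ℤ) |
    (0, 0) ∉ S ∧ S.card = k ∧ ∃ b ∈ B, ∀ z ∈ S, b ∈ cell n z}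

/-- The weight of the `n × n` configuration with set of black pixels `B`. -/
def weight (n : ℕ) (B : Finset (ℤ × ℤ)) : ℝ :=
  ∑ k ∈ Finset.Icc 1 (n ^ 2), (-1 : ℝ) ^ (k - 1) * (1 / (k : ℝ)) * (cellCount n B (k - 1) : ℝ)

/-- The point `a (z + c)` of the scaled and translated lattice `a Λ_c`. -/
def gridPoint (ξ : Module.Basis (Fin 2) ℝ Plane) (a : ℝ) (c : Plane) (z : ℤ × ℤ) : Plane :=
  a • (latticePoint ξ z + c)

/-- The number of occurrences in the image `X ∩ a Λ_c` of the `n × n` configuration with black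
pixels `B` and white pixels `C_{0,0}^n \ B`: the number of `z ∈ Λ` with
`a (z + B + c) ⊆ X` and `a (z + W + c) ⊆ Xᶜ`. -/
def occurrences (n : ℕ) (ξ : Module.Basis (Fin 2) ℝ Plane) (a : ℝ) (c : Plane)
    (X : Set Plane) (B : Finset (ℤ × ℤ)) : ℕ :=
  Set.ncard {z : ℤ × ℤ |
    (∀ b ∈ B, gridPoint ξ a c (z + b) ∈ X) ∧
    (∀ w ∈ cell n (0, 0) \ B, gridPoint ξ a c (z + w) ∉ X)}

/-- The local estimator: the sum of weight times number of occurrences over all `n × n`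
configurations having at least one black pixel. -/
def localEuler (n : ℕ) (ξ : Module.Basis (Fin 2) ℝ Plane) (a : ℝ) (c : Plane)
    (X : Set Plane) : ℝ :=
  ∑ B ∈ (cell n (0, 0)).powerset.filter (fun B => B.Nonempty),
    weight n B * (occurrences n ξ a c X B : ℝ)

/-- The class of compact convex sets with non-empty interior. -/
def convexBodies : Set (Set Plane) :=
  {K | IsCompact K ∧ Convex ℝ K ∧ (interior K).Nonempty}

/-- The convex polygons with non-empty interior. -/
def convexPolygons : Set (Set Plane) :=
  {P | (∃ F : Finset Plane, P = convexHull ℝ (F : Set Plane)) ∧ (interior P).Nonempty}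

/-- The lattice points `λ₁ ξ₁ + λ₂ ξ₂` with `-n < λ₁, λ₂ < n`, that is, the differences of two
points of `C_{0,0}^n`. -/
def differenceCell (n : ℕ) : Finset (ℤ × ℤ) :=
  Finset.Ioo (-(n : ℤ)) n ×ˢ Finset.Ioo (-(n : ℤ)) n

/-- `x` is an `n`-critical boundary point of `K`: for no `a > 0` does `K - x` contain a nonzero
point of `a` times the difference cell. -/
def IsCritical (n : ℕ) (ξ : Module.Basis (Fin 2) ℝ Plane) (K : Set Plane) (x : Plane) : Prop :=
  x ∈ frontier K ∧
    ∀ a : ℝ, 0 < a →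
      ((fun y => y - x) '' K) ∩
        ((fun z => a • latticePoint ξ z) '' (differenceCell n : Set (ℤ × ℤ))) = {0}

/-- The intrinsic volume `V₀`, i.e. the leading coefficient in the Steiner formula
`H²(K ⊕ B(r)) = V₂(K) + 2 r V₁(K) + π r² V₀(K)`. -/
def eulerChar (K : Set Plane) : ℝ :=
  limUnder atTop fun r : ℝ =>
    (volume (K + Metric.closedBall (0 : Plane) r)).toReal / (Real.pi * r ^ 2)

/-- Multigrid convergence on the class `𝒮` of an estimator, given as a function of the lattice
distance `a`, the translation `c` and the set; only the untranslated lattice is used. -/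
def MultigridConvergent (Vhat : ℝ → Plane → Set Plane → ℝ) (V : Set Plane → ℝ)
    (𝒮 : Set (Set Plane)) : Prop :=
  ∀ X ∈ 𝒮, Tendsto (fun a : ℝ => Vhat a 0 X) (𝓝[>] 0) (𝓝 (V X))

/-- The interior angle of a convex set `K` at `x`: the opening angle of the cone of `K` at `x`.
At a vertex of a convex polygon it is the usual interior angle. -/
def interiorAngle (K : Set Plane) (x : Plane) : ℝ :=
  sSup {θ : ℝ | ∃ y ∈ K, ∃ z ∈ K, y ≠ x ∧ z ≠ x ∧ θ = EuclideanGeometry.angle y x z}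

/-- All interior angles at extreme points (for a polygon: at the vertices) are at least `ψ`. -/
def AnglesAtLeast (ψ : ℝ) (K : Set Plane) : Prop :=
  ∀ v ∈ K.extremePoints ℝ, ψ ≤ interiorAngle K v

/-- The standard basis of the plane, spanning the lattice `ℤ²`. -/
def standardBasis : Module.Basis (Fin 2) ℝ Plane :=
  (EuclideanSpace.basisFun (Fin 2) ℝ).toBasis

end LocalEuler

end

/-! The weights are chosen so that the estimator is the Euler characteristic of a simplicial
complex. Let `A` be the finite set of lattice points seen in `K`. The factor `1/k` in the weight
shares each nonempty set `T` of `k` positions equally among its members, so summing over all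
positions gives the Euler characteristic of the nerve of the sets `C_z ∩ A` (`sum_weight_pixels`).
Dowker duality (`sum_sign_dual`) replaces this nerve by the complex of nonempty subsets of `A` that
fit into one cell. Sorting these subsets by their least coordinates turns the Euler characteristic
into a sum over columns of differences of numbers of chains (`localEuler_eq_sum_ends`), where a
chain is a maximal run of integers with gaps less than `n`.

Part (i): sweep `A` outwards from a column `k₀` near an interior point of `K`. If each further
column is close to one nearer to `k₀`, then, by digital convexity, attaching it changes no number of
chains (`card_ends_union`), and the sum telescopes to the single chain of `k₀` (`sum_ends_eq_one`).
The closeness comes from the absence of critical points: from every point of `K` some difference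
vector leads into `K`, by compactness for a uniform length (`exists_uniform_step`). Such a step
either goes inwards and reaches a nearby column, or forces the column to be so long that it shares a
row with its inner neighbour (`exists_adjacent_column`).

Part (ii): at a critical point with `n ≥ 2`, the directions into `K` lie in one open quadrant of `ξ`
and the cone of any two of them contains no difference vector (`IsCritical.freePair`). Vectors in
one open quadrant enclose angles bounded away from `π`, and rounding shows that a cone of fixed
width contains difference vectors once `n` is large. Part (iii): for `n = 2` and `ℤ²` the cone lies
in an open octant; finiteness of the generating set makes the bound of 45 degrees strict. -/

namespace LocalEuler

noncomputable section

open scoped Classical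

/-! ### Signed sums over finite sets and Dowker duality -/

/-- The indicator of a proposition. -/
def ind (p : Prop) : ℝ := if p then 1 else 0

theorem ind_pos {p : Prop} (h : p) : ind p = 1 := if_pos h

theorem ind_neg {p : Prop} (h : ¬ p) : ind p = 0 := if_neg h

theorem ite_eq_ind (p : Prop) [Decidable p] : (if p then (1 : ℝ) else 0) = ind p := by
  by_cases hp : p <;> simp [ind, hp]

theorem ind_and (p q : Prop) : ind (p ∧ q) = ind p * ind q := by
  by_cases hp : p <;> by_cases hq : q <;> simp [ind, hp, hq]

theorem ind_congr {p q : Prop} (h : p ↔ q) : ind p = ind q := by rw [propext h]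

theorem sum_sign_nonempty {α : Type*} (X : Finset α) :
    ∑ S ∈ X.powerset with S.Nonempty, (-1 : ℝ) ^ (S.card + 1) = ind (X.Nonempty) := by
  have h := congrArg (Int.cast : ℤ → ℝ) (Finset.sum_powerset_neg_one_pow_card (x := X))
  push_cast at h
  have h2 : ∑ S ∈ X.powerset, (-1 : ℝ) ^ S.card
      = 1 - ∑ S ∈ X.powerset with S.Nonempty, (-1 : ℝ) ^ (S.card + 1) := by
    rw [← Finset.sum_filter_add_sum_filter_not X.powerset (fun S => S.Nonempty)]
    have : X.powerset.filter (fun S => ¬ S.Nonempty) = {∅} := by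
      ext S
      simp only [Finset.mem_filter, Finset.mem_powerset, Finset.not_nonempty_iff_eq_empty,
        Finset.mem_singleton]
      constructor
      · exact fun h => h.2
      · rintro rfl; simp
    rw [this]
    simp only [pow_succ, mul_neg, mul_one, Finset.sum_neg_distrib, Finset.sum_singleton,
      Finset.card_empty, pow_zero]
    ring
  rw [h2] at h
  rcases X.eq_empty_or_nonempty with rfl | hX
  · have h3 : (∅ : Finset α).powerset.filter (fun S => S.Nonempty) = ∅ := by
      refine Finset.filter_eq_empty_iff.2 fun S hS => ?_
      rw [Finset.powerset_empty, Finset.mem_singleton] at hS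
      simp [hS]
    rw [h3, ind_neg (by simp), Finset.sum_empty]
  · rw [if_neg hX.ne_empty] at h
    rw [ind_pos hX]
    linarith

theorem sum_sign_subset {α : Type*} (A : Finset α) (Q : α → Prop) :
    ∑ S ∈ A.powerset with S.Nonempty,
      (-1 : ℝ) ^ (S.card + 1) * ind (∀ s ∈ S, Q s)
      = ind (∃ s ∈ A, Q s) := by
  have h := sum_sign_nonempty (A.filter Q)
  have e : ind (∃ s ∈ A, Q s) = ind ((A.filter Q).Nonempty) := by
    simp only [Finset.Nonempty, Finset.mem_filter]
  rw [e, ← h]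
  simp only [ind, mul_ite, mul_one, mul_zero]
  rw [← Finset.sum_filter]
  congr 1
  ext S
  simp only [Finset.mem_filter, Finset.mem_powerset, Finset.subset_iff]
  constructor
  · rintro ⟨⟨h1, h2⟩, h3⟩
    exact ⟨fun s hs => ⟨h1 hs, h3 s hs⟩, h2⟩
  · rintro ⟨h1, h2⟩
    exact ⟨⟨fun s hs => (h1 hs).1, h2⟩, fun s hs => (h1 hs).2⟩

/-- Dowker duality for Euler characteristics. -/
theorem sum_sign_dual {α β : Type*} (A : Finset α) (U : Finset β) (r : α → β → Prop) :
    ∑ T ∈ U.powerset with T.Nonempty,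
      (-1 : ℝ) ^ (T.card + 1) * ind (∃ b ∈ A, ∀ t ∈ T, r b t)
    = ∑ S ∈ A.powerset with S.Nonempty,
      (-1 : ℝ) ^ (S.card + 1) * ind (∃ t ∈ U, ∀ s ∈ S, r s t) := by
  -- Both sides count, with sign, the pairs `(S, T)` in which every element of `S` is related to
  -- every element of `T`.
  have h1 : ∀ T : Finset β, ind (∃ b ∈ A, ∀ t ∈ T, r b t)
      = ∑ S ∈ A.powerset with S.Nonempty,
        (-1 : ℝ) ^ (S.card + 1) * ind (∀ s ∈ S, ∀ t ∈ T, r s t) := fun T =>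
    (sum_sign_subset A fun b => ∀ t ∈ T, r b t).symm
  have h2 : ∀ S : Finset α, ind (∃ t ∈ U, ∀ s ∈ S, r s t)
      = ∑ T ∈ U.powerset with T.Nonempty,
        (-1 : ℝ) ^ (T.card + 1) * ind (∀ t ∈ T, ∀ s ∈ S, r s t) := fun S =>
    (sum_sign_subset U fun t => ∀ s ∈ S, r s t).symm
  simp only [h1, h2, Finset.mul_sum]
  rw [Finset.sum_comm]
  refine Finset.sum_congr rfl fun S _ => Finset.sum_congr rfl fun T _ => ?_
  have : (∀ s ∈ S, ∀ t ∈ T, r s t) ↔ ∀ t ∈ T, ∀ s ∈ S, r s t :=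
    ⟨fun h t ht s hs => h s hs t ht, fun h s hs t ht => h t ht s hs⟩
  simp only [this]
  ring

/-! ### Windows, chains and their end points -/

/-- A set of integers lies in a window of length `n` iff it lies in the window that starts at its
minimum. -/
theorem sum_window {α : Type*} (S : Finset α) (hS : S.Nonempty) (f : α → ℤ) (n : ℤ)
    (X : Finset ℤ) (hX : ∀ s ∈ S, f s ∈ X) :
    ∑ i ∈ X, (ind (∀ s ∈ S, i ≤ f s ∧ f s < i + n)
      - ind (∀ s ∈ S, i + 1 ≤ f s ∧ f s < i + n))
    = ind (∃ i, ∀ s ∈ S, i ≤ f s ∧ f s < i + n) := by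
  obtain ⟨m, hm, hmin⟩ := S.exists_min_image f hS
  have key : ∀ i, (ind (∀ s ∈ S, i ≤ f s ∧ f s < i + n)
      - ind (∀ s ∈ S, i + 1 ≤ f s ∧ f s < i + n))
      = if i = f m then ind (∀ s ∈ S, f s < f m + n) else 0 := by
    intro i
    by_cases hi : i = f m
    · subst hi
      have h1 : ¬ ∀ s ∈ S, f m + 1 ≤ f s ∧ f s < f m + n := fun h => by
        have := (h m hm).1
        omega
      have h2 : (∀ s ∈ S, f m ≤ f s ∧ f s < f m + n) ↔ ∀ s ∈ S, f s < f m + n :=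
        ⟨fun h s hs => (h s hs).2, fun h s hs => ⟨hmin s hs, h s hs⟩⟩
      rw [ind_neg h1, if_pos rfl, ind_congr h2, sub_zero]
    · have h2 : (∀ s ∈ S, i ≤ f s ∧ f s < i + n) ↔ ∀ s ∈ S, i + 1 ≤ f s ∧ f s < i + n := by
        constructor
        · intro h s hs
          have := (h m hm).1
          have := hmin s hs
          exact ⟨by omega, (h s hs).2⟩
        · intro h s hs
          have := h s hs
          exact ⟨by omega, this.2⟩
      rw [if_neg hi]
      simp only [h2, sub_self]
  simp only [key]
  rw [Finset.sum_ite_eq' X (f m), if_pos (hX m hm)]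
  have : (∃ i, ∀ s ∈ S, i ≤ f s ∧ f s < i + n) ↔ ∀ s ∈ S, f s < f m + n := by
    constructor
    · rintro ⟨i, h⟩ s hs
      have := (h m hm).1
      have := (h s hs).2
      omega
    · exact fun h => ⟨f m, fun s hs => ⟨hmin s hs, h s hs⟩⟩
  simp only [this]

/-- The last points of the maximal chains of `P` with steps less than `n`. -/
def ends (n : ℤ) (P : Finset ℤ) : Finset ℤ :=
  P.filter fun m => ∀ p ∈ P, ¬ (m < p ∧ p < m + n)

/-- The second coordinates of the points of `A` whose first coordinate is in `[k, l)`. -/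
def proj (A : Finset (ℤ × ℤ)) (k l : ℤ) : Finset ℤ :=
  (A.filter fun z => k ≤ z.1 ∧ z.1 < l).image Prod.snd

theorem mem_proj {A : Finset (ℤ × ℤ)} {k l y : ℤ} :
    y ∈ proj A k l ↔ ∃ x, k ≤ x ∧ x < l ∧ (x, y) ∈ A := by
  simp only [proj, Finset.mem_image, Finset.mem_filter, Prod.exists, exists_eq_right]
  constructor
  · rintro ⟨x, h1, h2, h3⟩; exact ⟨x, h2, h3, h1⟩
  · rintro ⟨x, h2, h3, h1⟩; exact ⟨x, h1, h2, h3⟩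

/-- An integer `j` ends a chain exactly when the window of height `n` starting at `j` meets the
strip but no longer does so after its first row is removed. -/
theorem card_ends_eq_sum (A : Finset (ℤ × ℤ)) (k l n : ℤ) (hn : 0 < n) (Y : Finset ℤ)
    (hY : ∀ z ∈ A, z.2 ∈ Y) :
    ((ends n (proj A k l)).card : ℝ) = ∑ j ∈ Y,
      (ind (∃ s ∈ A, (k ≤ s.1 ∧ s.1 < l) ∧ (j ≤ s.2 ∧ s.2 < j + n))
      - ind (∃ s ∈ A, (k ≤ s.1 ∧ s.1 < l) ∧ (j + 1 ≤ s.2 ∧ s.2 < j + n))) := by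
  have hsub : ends n (proj A k l) = Y.filter fun j => j ∈ ends n (proj A k l) := by
    ext j
    simp only [Finset.mem_filter]
    refine ⟨fun h => ⟨?_, h⟩, fun h => h.2⟩
    obtain ⟨x, _, _, h⟩ := mem_proj.1 (Finset.mem_filter.1 h).1
    exact hY _ h
  rw [hsub, Finset.card_filter]
  push_cast
  refine Finset.sum_congr rfl fun j _ => ?_
  simp only [ends, Finset.mem_filter, mem_proj]
  by_cases h2 : ∃ s ∈ A, (k ≤ s.1 ∧ s.1 < l) ∧ (j + 1 ≤ s.2 ∧ s.2 < j + n)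
  · obtain ⟨s, hs, h3, h4⟩ := h2
    rw [if_neg, ind_pos ⟨s, hs, h3, by omega, h4.2⟩, ind_pos ⟨s, hs, h3, h4⟩, sub_self]
    rintro ⟨-, h5⟩
    exact h5 s.2 ⟨s.1, h3.1, h3.2, hs⟩ ⟨by omega, h4.2⟩
  · rw [ind_neg h2, sub_zero, ite_eq_ind]
    refine ind_congr ?_
    constructor
    · rintro ⟨⟨x, h3, h4, h5⟩, -⟩
      exact ⟨(x, j), h5, ⟨h3, h4⟩, le_rfl, by simpa using hn⟩
    · rintro ⟨s, hs, h3, h4⟩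
      have : s.2 = j := by
        by_contra h
        exact h2 ⟨s, hs, h3, by omega, h4.2⟩
      refine ⟨⟨s.1, h3.1, h3.2, this ▸ hs⟩, ?_⟩
      rintro p ⟨x, h5, h6, h7⟩ ⟨h8, h9⟩
      exact h2 ⟨(x, p), h7, ⟨h5, h6⟩, h8, h9⟩

/-- `sum_window` pins the window of `S` at its least coordinate in each direction. Expanding the
product leaves four rectangles, and for each of them `sum_sign_subset` reduces the signed sum over
`S` to whether the rectangle meets `A`. -/
theorem sum_sign_window (A : Finset (ℤ × ℤ)) (n : ℤ) (hn : 0 < n) (X : Finset ℤ)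
    (hX : ∀ z ∈ A, z.1 ∈ X) :
    ∑ S ∈ A.powerset with S.Nonempty, (-1 : ℝ) ^ (S.card + 1) *
      ind ((∃ i, ∀ s ∈ S, i ≤ s.1 ∧ s.1 < i + n) ∧ (∃ j, ∀ s ∈ S, j ≤ s.2 ∧ s.2 < j + n))
    = ∑ i ∈ X, (((ends n (proj A i (i + n))).card : ℝ)
        - ((ends n (proj A (i + 1) (i + n))).card : ℝ)) := by
  set Y := A.image Prod.snd
  have hY : ∀ z ∈ A, z.2 ∈ Y := fun z hz => Finset.mem_image_of_mem _ hz
  have step : ∀ S ∈ A.powerset.filter (fun S => S.Nonempty), (-1 : ℝ) ^ (S.card + 1) *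
      ind ((∃ i, ∀ s ∈ S, i ≤ s.1 ∧ s.1 < i + n) ∧ (∃ j, ∀ s ∈ S, j ≤ s.2 ∧ s.2 < j + n)) = ∑ i ∈ X, ∑ j ∈ Y, (-1 : ℝ) ^ (S.card + 1) *
      ((ind (∀ s ∈ S, i ≤ s.1 ∧ s.1 < i + n)
      - ind (∀ s ∈ S, i + 1 ≤ s.1 ∧ s.1 < i + n)) *
      (ind (∀ s ∈ S, j ≤ s.2 ∧ s.2 < j + n)
      - ind (∀ s ∈ S, j + 1 ≤ s.2 ∧ s.2 < j + n))) := by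
    intro S hS
    simp only [Finset.mem_filter, Finset.mem_powerset] at hS
    simp only [← Finset.mul_sum]
    rw [← Finset.sum_mul, sum_window S hS.2 Prod.fst n X fun s hs => hX s (hS.1 hs),
      sum_window S hS.2 Prod.snd n Y fun s hs => hY s (hS.1 hs)]
    rw [ind_and]
  rw [Finset.sum_congr rfl step, Finset.sum_comm]
  refine Finset.sum_congr rfl fun i _ => ?_
  rw [Finset.sum_comm, card_ends_eq_sum A i (i + n) n hn Y hY,
    card_ends_eq_sum A (i + 1) (i + n) n hn Y hY, ← Finset.sum_sub_distrib]
  refine Finset.sum_congr rfl fun j _ => ?_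
  simp only [← sum_sign_subset, ← Finset.sum_sub_distrib]
  refine Finset.sum_congr rfl fun S _ => ?_
  have e : ∀ Q R : ℤ × ℤ → Prop,
      ind (∀ s ∈ S, Q s ∧ R s) = ind (∀ s ∈ S, Q s) * ind (∀ s ∈ S, R s) := fun Q R => by
    rw [← ind_and]
    exact ind_congr ⟨fun h => ⟨fun s hs => (h s hs).1, fun s hs => (h s hs).2⟩,
      fun h s hs => ⟨h.1 s hs, h.2 s hs⟩⟩
  have e' := fun i j k l : ℤ => e (fun s => i ≤ s.1 ∧ s.1 < k) (fun s => j ≤ s.2 ∧ s.2 < l)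
  rw [e', e', e', e']
  ring

/-- Adding `I` creates no new chain because of `hadj`, and merges no chains because of `hP`: `I` has
no point in a gap between two points of `P`. As `n ≥ 2`, consecutive integers belong to the same
chain. -/
theorem card_ends_union {n : ℤ} (hn : 2 ≤ n) {P I : Finset ℤ}
    (hI : ∀ x ∈ I, ∀ z ∈ I, ∀ y, x ≤ y → y ≤ z → y ∈ I)
    (hadj : ∃ p ∈ P, ∃ i ∈ I, |p - i| < n)
    (hP : ∀ p ∈ P, ∀ q ∈ P, ∀ i ∈ I, p < i → i < q → i ∈ P) :
    (ends n (P ∪ I)).card = (ends n P).card := by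
  obtain ⟨p₀, hp₀, i₀, hi₀, h₀⟩ := hadj
  rw [abs_lt] at h₀
  obtain ⟨t, ht, htmax⟩ := I.exists_max_image id ⟨i₀, hi₀⟩
  simp only [id] at htmax
  have hit := htmax i₀ hi₀
  -- With no point of `P` in `[t, t + n)`, the last point `q` of `P` below `t` is an end, and `t`
  -- takes its place. Otherwise the set of ends does not change at all.
  by_cases hc : ∀ p ∈ P, ¬ (t ≤ p ∧ p < t + n)
  · have hp₀t : p₀ < t := by
      by_contra h
      exact hc p₀ hp₀ ⟨by omega, by omega⟩
    obtain ⟨q, hq, hqmax⟩ := (P.filter (· < t)).exists_max_image id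
      ⟨p₀, Finset.mem_filter.2 ⟨hp₀, hp₀t⟩⟩
    simp only [Finset.mem_filter, id] at hq hqmax
    have hp₀q := hqmax p₀ ⟨hp₀, hp₀t⟩
    have hqlt : ∀ p ∈ P, q < p → t + n ≤ p := by
      intro p hp hqp
      by_contra h
      have h1 := hc p hp
      have h2 : ¬ p < t := fun h => by have := hqmax p ⟨hp, h⟩; omega
      omega
    have hqI : ∃ i ∈ I, q < i ∧ i < q + n := by
      by_cases h : i₀ ≤ q
      · exact ⟨q + 1, hI i₀ hi₀ t ht _ (by omega) (by omega), by omega, by omega⟩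
      · exact ⟨i₀, hi₀, by omega, by omega⟩
    have hqe : q ∈ ends n P := by
      refine Finset.mem_filter.2 ⟨hq.1, fun p hp h => ?_⟩
      have := hqlt p hp h.1
      omega
    have hte : t ∉ (ends n P).erase q := fun h =>
      hc t (Finset.mem_filter.1 (Finset.mem_of_mem_erase h)).1 ⟨le_rfl, by omega⟩
    have : ends n (P ∪ I) = insert t ((ends n P).erase q) := by
      ext m
      simp only [ends, Finset.mem_filter, Finset.mem_union, Finset.mem_insert, Finset.mem_erase]
      constructor
      · rintro ⟨hm | hm, h⟩
        · refine Or.inr ⟨?_, hm, fun p hp => h p (Or.inl hp)⟩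
          rintro rfl
          obtain ⟨i, hi, h2⟩ := hqI
          exact h i (Or.inr hi) h2
        · left
          by_contra hmt
          have := htmax m hm
          exact h (m + 1) (Or.inr (hI m hm t ht _ (by omega) (by omega))) ⟨by omega, by omega⟩
      · rintro (rfl | ⟨hmq, hm, h⟩)
        · refine ⟨Or.inr ht, ?_⟩
          rintro p (hp | hp) ⟨h1, h2⟩
          · exact hc p hp ⟨h1.le, h2⟩
          · have := htmax p hp
            omega
        · refine ⟨Or.inl hm, ?_⟩
          rintro p (hp | hp) ⟨h1, h2⟩
          · exact h p hp ⟨h1, h2⟩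
          · have hpt := htmax p hp
            have hmq' : m < q := by
              by_contra h3
              have := hqlt m hm (by omega)
              omega
            have hqm : m + n ≤ q := by
              by_contra h3
              exact h q hq.1 ⟨hmq', by omega⟩
            exact h p (hP m hm q hq.1 p hp h1 (by omega)) ⟨h1, h2⟩
    rw [this, Finset.card_insert_of_notMem hte, Finset.card_erase_of_mem hqe]
    have := Finset.card_pos.2 ⟨q, hqe⟩
    omega
  · push Not at hc
    obtain ⟨q, hq, hqt, hqn⟩ := hc
    congr 1
    ext m
    simp only [ends, Finset.mem_filter, Finset.mem_union]
    constructor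
    · rintro ⟨hm | hm, h⟩
      · exact ⟨hm, fun p hp => h p (Or.inl hp)⟩
      · have hmt : m = t := by
          by_contra hmt
          have := htmax m hm
          exact h (m + 1) (Or.inr (hI m hm t ht _ (by omega) (by omega))) ⟨by omega, by omega⟩
        subst hmt
        have : q = m := by
          by_contra h2
          exact h q (Or.inl hq) ⟨by omega, hqn⟩
        exact ⟨this ▸ hq, fun p hp => h p (Or.inl hp)⟩
    · rintro ⟨hm, h⟩
      refine ⟨Or.inl hm, ?_⟩
      rintro p (hp | hp) ⟨h1, h2⟩
      · exact h p hp ⟨h1, h2⟩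
      · have hpt := htmax p hp
        have hqm : m + n ≤ q := by
          by_contra h3
          exact h q hq ⟨by omega, by omega⟩
        exact h p (hP m hm q hq p hp h1 (by omega)) ⟨h1, h2⟩

theorem card_ends_interval {n : ℤ} (hn : 2 ≤ n) {I : Finset ℤ} (hne : I.Nonempty)
    (hI : ∀ x ∈ I, ∀ z ∈ I, ∀ y, x ≤ y → y ≤ z → y ∈ I) : (ends n I).card = 1 := by
  obtain ⟨t, ht, htmax⟩ := I.exists_max_image id hne
  simp only [id] at htmax
  rw [Finset.card_eq_one]
  refine ⟨t, ?_⟩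
  ext m
  simp only [ends, Finset.mem_filter, Finset.mem_singleton]
  constructor
  · rintro ⟨hm, h⟩
    by_contra hmt
    have := htmax m hm
    exact h (m + 1) (hI m hm t ht _ (by omega) (by omega)) ⟨by omega, by omega⟩
  · rintro rfl
    refine ⟨ht, fun p hp h => ?_⟩
    have := htmax p hp
    omega

/-! ### The estimator as an Euler characteristic -/

theorem mem_cell {n : ℕ} {z b : ℤ × ℤ} :
    b ∈ cell n z ↔ (z.1 ≤ b.1 ∧ b.1 < z.1 + n) ∧ (z.2 ≤ b.2 ∧ b.2 < z.2 + n) := by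
  simp [cell, Finset.mem_product]

theorem add_mem_cell_add {n : ℕ} {z b s : ℤ × ℤ} : z + b ∈ cell n (z + s) ↔ b ∈ cell n s := by
  simp only [mem_cell, Prod.fst_add, Prod.snd_add]
  omega

theorem add_mem_cell_self {n : ℕ} {z b : ℤ × ℤ} : z + b ∈ cell n z ↔ b ∈ cell n (0, 0) := by
  simp only [mem_cell, Prod.fst_add, Prod.snd_add]
  omega

theorem card_le_of_mem_cell {n : ℕ} {T : Finset (ℤ × ℤ)} {b : ℤ × ℤ}
    (h : ∀ t ∈ T, b ∈ cell n t) : T.card ≤ n ^ 2 := by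
  have hsub : T ⊆ Finset.Ioc (b.1 - n) b.1 ×ˢ Finset.Ioc (b.2 - n) b.2 := by
    intro t ht
    have := mem_cell.1 (h t ht)
    simp only [Finset.mem_product, Finset.mem_Ioc]
    omega
  refine (Finset.card_le_card hsub).trans ?_
  simp [Finset.card_product, sq]

/-- The black pixels of the configuration at `z` in the image with set of black pixels `A`. -/
def pixels (n : ℕ) (A : Finset (ℤ × ℤ)) (z : ℤ × ℤ) : Finset (ℤ × ℤ) :=
  (cell n (0, 0)).filter fun b => z + b ∈ A

/-- The bijection is `S ↦ {z} ∪ (z + S)`; since `0 ∉ S`, it raises the cardinality by exactly one.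
-/
theorem cellCount_pixels (n : ℕ) (A U : Finset (ℤ × ℤ))
    (hU : ∀ t, ∀ b ∈ A, b ∈ cell n t → t ∈ U) (z : ℤ × ℤ) (k : ℕ) :
    cellCount n (pixels n A z) k = (U.powerset.filter fun T =>
      (z ∈ T ∧ ∃ b ∈ A, ∀ t ∈ T, b ∈ cell n t) ∧ T.card = k + 1).card := by
  rw [cellCount, ← Set.ncard_coe_finset]
  have h0 : ∀ S : Finset (ℤ × ℤ), (0, 0) ∉ S → z ∉ S.image (z + ·) := by
    intro S hS h
    obtain ⟨s, hs, h⟩ := Finset.mem_image.1 h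
    obtain rfl : s = 0 := by simpa using h
    exact hS hs
  have hinj : Function.Injective fun s : ℤ × ℤ => z + s := add_right_injective z
  refine Set.ncard_congr (fun S _ => insert z (S.image (z + ·))) ?_ ?_ ?_
  · rintro S ⟨hS, hk, b, hb, hbS⟩
    obtain ⟨hb0, hbA⟩ := Finset.mem_filter.1 hb
    have hg : ∀ t ∈ insert z (S.image (z + ·)), z + b ∈ cell n t := by
      intro t ht
      rcases Finset.mem_insert.1 ht with rfl | ht
      · exact add_mem_cell_self.2 hb0
      · obtain ⟨s, hs, rfl⟩ := Finset.mem_image.1 ht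
        exact add_mem_cell_add.2 (hbS s hs)
    simp only [Finset.coe_filter, Finset.mem_powerset, Set.mem_ofPred_eq]
    refine ⟨fun t ht => hU t _ hbA (hg t ht), ⟨Finset.mem_insert_self _ _, _, hbA, hg⟩, ?_⟩
    rw [Finset.card_insert_of_notMem (h0 S hS), Finset.card_image_of_injective _ hinj, hk]
  · rintro S S' ⟨hS, -⟩ ⟨hS', -⟩ h
    have := congrArg (fun X => Finset.erase X z) h
    simp only [Finset.erase_insert (h0 S hS), Finset.erase_insert (h0 S' hS')] at this
    exact Finset.image_injective hinj this
  · intro T hT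
    simp only [Finset.coe_filter, Finset.mem_powerset, Set.mem_ofPred_eq] at hT
    obtain ⟨-, ⟨hz, b, hb, hbT⟩, hk⟩ := hT
    have him : ((T.erase z).image (· - z)).image (z + ·) = T.erase z := by
      rw [Finset.image_image]
      simp [Function.comp_def]
    refine ⟨(T.erase z).image (· - z), ⟨?_, ?_, b - z, ?_, ?_⟩, ?_⟩
    · intro h
      obtain ⟨t, ht, h⟩ := Finset.mem_image.1 h
      have : t = z := sub_eq_zero.1 h
      exact Finset.ne_of_mem_erase ht this
    · rw [Finset.card_image_of_injective _ (sub_left_injective), Finset.card_erase_of_mem hz, hk]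
      rfl
    · refine Finset.mem_filter.2 ⟨?_, by simpa using hb⟩
      rw [← add_mem_cell_self (z := z)]
      simpa using hbT z hz
    · intro s hs
      obtain ⟨t, ht, rfl⟩ := Finset.mem_image.1 hs
      rw [← add_mem_cell_add (z := z)]
      simpa using hbT t (Finset.mem_of_mem_erase ht)
    · simp only [him, Finset.insert_erase hz]

/-- The index `k` of the weight is the cardinality of `T`. Stopping at `n ^ 2` loses nothing, since
a point lies in at most `n ^ 2` cells. -/
theorem weight_pixels (n : ℕ) (A U : Finset (ℤ × ℤ))
    (hU : ∀ t, ∀ b ∈ A, b ∈ cell n t → t ∈ U) (z : ℤ × ℤ) :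
    weight n (pixels n A z) = ∑ T ∈ U.powerset with z ∈ T ∧ ∃ b ∈ A, ∀ t ∈ T, b ∈ cell n t,
      (-1 : ℝ) ^ (T.card + 1) * (1 / (T.card : ℝ)) := by
  rw [← Finset.sum_fiberwise_of_maps_to (s := U.powerset.filter _)
    (t := Finset.Icc 1 (n ^ 2)) (g := Finset.card), weight]
  · refine Finset.sum_congr rfl fun k hk => ?_
    obtain ⟨hk1, -⟩ := Finset.mem_Icc.1 hk
    obtain ⟨k, rfl⟩ : ∃ j, k = j + 1 := ⟨k - 1, by omega⟩
    rw [Finset.sum_congr rfl (g := fun _ => (-1 : ℝ) ^ k * (1 / ((k + 1 : ℕ) : ℝ)))]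
    · rw [Finset.sum_const, nsmul_eq_mul, Finset.filter_filter, Nat.add_sub_cancel,
        cellCount_pixels n A U hU, mul_comm]
    · intro T hT
      rw [(Finset.mem_filter.1 hT).2]
      ring
  · intro T hT
    obtain ⟨-, hz, b, -, hb⟩ := Finset.mem_filter.1 hT
    exact Finset.mem_Icc.2 ⟨Finset.card_pos.2 ⟨z, hz⟩, card_le_of_mem_cell hb⟩

/-- Each `T` occurs once for every `z ∈ T`, which cancels the factor `1 / T.card`. -/
theorem sum_weight_pixels (n : ℕ) (A U : Finset (ℤ × ℤ))
    (hU : ∀ t, ∀ b ∈ A, b ∈ cell n t → t ∈ U) :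
    ∑ z ∈ U, weight n (pixels n A z) = ∑ T ∈ U.powerset with T.Nonempty,
      (-1 : ℝ) ^ (T.card + 1) * ind (∃ b ∈ A, ∀ t ∈ T, b ∈ cell n t) := by
  simp only [weight_pixels n A U hU, Finset.sum_filter]
  rw [Finset.sum_comm]
  refine Finset.sum_congr rfl fun T hT => ?_
  by_cases hg : ∃ b ∈ A, ∀ t ∈ T, b ∈ cell n t
  · simp only [hg, and_true]
    rw [← Finset.sum_filter, Finset.filter_mem_eq_inter,
      Finset.inter_eq_right.2 (Finset.mem_powerset.1 hT), Finset.sum_const, nsmul_eq_mul,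
      ind_pos trivial]
    split_ifs with h
    · have : (T.card : ℝ) ≠ 0 := by simpa using h.ne_empty
      field_simp
    · simp [Finset.not_nonempty_iff_eq_empty.1 h]
  · simp only [hg, and_false, if_false, Finset.sum_const_zero, ind_neg not_false, mul_zero, ite_self]

/-- Positions are grouped by the configuration they see. Those in `U` are the ones that see a black
pixel, in accordance with the restriction to nonempty `B`. -/
theorem localEuler_eq_sum_weight (n : ℕ) (ξ : Module.Basis (Fin 2) ℝ Plane) (a : ℝ) (c : Plane)
    (X : Set Plane) (A U : Finset (ℤ × ℤ)) (hA : ∀ z, z ∈ A ↔ gridPoint ξ a c z ∈ X)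
    (hU : ∀ t, t ∈ U ↔ ∃ b ∈ A, b ∈ cell n t) :
    localEuler n ξ a c X = ∑ z ∈ U, weight n (pixels n A z) := by
  rw [← Finset.sum_fiberwise_of_maps_to (s := U)
    (t := (cell n (0, 0)).powerset.filter fun B => B.Nonempty) (g := pixels n A), localEuler]
  · refine Finset.sum_congr rfl fun B hB => ?_
    obtain ⟨hB, b, hb⟩ := Finset.mem_filter.1 hB
    rw [Finset.mem_powerset] at hB
    rw [Finset.sum_congr rfl (g := fun _ => weight n B)
      (fun z hz => by rw [(Finset.mem_filter.1 hz).2]), Finset.sum_const, nsmul_eq_mul, mul_comm]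
    congr 2
    rw [occurrences, ← Set.ncard_coe_finset]
    congr 1
    ext z
    simp only [Set.mem_ofPred_eq, Finset.coe_filter, ← hA, hU]
    constructor
    · rintro ⟨h1, h2⟩
      refine ⟨⟨z + b, h1 b hb, ?_⟩, ?_⟩
      · exact add_mem_cell_self.2 (hB hb)
      · ext s
        refine ⟨fun h => ?_, fun h => Finset.mem_filter.2 ⟨hB h, h1 s h⟩⟩
        obtain ⟨h3, h4⟩ := Finset.mem_filter.1 h
        by_contra h5
        exact h2 s (Finset.mem_sdiff.2 ⟨h3, h5⟩) h4
    · rintro ⟨-, rfl⟩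
      refine ⟨fun s hs => (Finset.mem_filter.1 hs).2, fun w hw h => ?_⟩
      obtain ⟨h3, h4⟩ := Finset.mem_sdiff.1 hw
      exact h4 (Finset.mem_filter.2 ⟨h3, h⟩)
  · intro z hz
    obtain ⟨b, hb, hbz⟩ := (hU z).1 hz
    refine Finset.mem_filter.2 ⟨Finset.mem_powerset.2 (Finset.filter_subset _ _), b - z,
      Finset.mem_filter.2 ⟨?_, by simpa using hb⟩⟩
    rw [← add_mem_cell_self (z := z)]
    simpa using hbz

theorem localEuler_eq_sum_ends (n : ℕ) (hn : 0 < n) (ξ : Module.Basis (Fin 2) ℝ Plane) (a : ℝ)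
    (c : Plane) (X : Set Plane) (A : Finset (ℤ × ℤ)) (hA : ∀ z, z ∈ A ↔ gridPoint ξ a c z ∈ X)
    (J : Finset ℤ) (hJ : ∀ z ∈ A, z.1 ∈ J) :
    localEuler n ξ a c X = ∑ i ∈ J, (((ends n (proj A i (i + n))).card : ℝ)
        - ((ends n (proj A (i + 1) (i + n))).card : ℝ)) := by
  set U : Finset (ℤ × ℤ) := A.biUnion fun b =>
    Finset.Ioc (b.1 - n) b.1 ×ˢ Finset.Ioc (b.2 - n) b.2
  have hU : ∀ t, t ∈ U ↔ ∃ b ∈ A, b ∈ cell n t := by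
    intro t
    simp only [U, Finset.mem_biUnion, Finset.mem_product, Finset.mem_Ioc, mem_cell]
    refine exists_congr fun b => and_congr_right fun _ => ?_
    omega
  rw [localEuler_eq_sum_weight n ξ a c X A U hA hU,
    sum_weight_pixels n A U fun t b hb h => (hU t).2 ⟨b, hb, h⟩,
    sum_sign_dual A U fun b t => b ∈ cell n t, ← sum_sign_window A n (by omega) J hJ]
  refine Finset.sum_congr rfl fun S hS => ?_
  obtain ⟨hS, s, hs⟩ := Finset.mem_filter.1 hS
  congr 1
  refine ind_congr ?_
  simp only [mem_cell]
  constructor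
  · rintro ⟨t, -, h⟩
    exact ⟨⟨t.1, fun s hs => (h s hs).1⟩, ⟨t.2, fun s hs => (h s hs).2⟩⟩
  · rintro ⟨⟨i, hi⟩, ⟨j, hj⟩⟩
    exact ⟨(i, j), (hU _).2 ⟨s, Finset.mem_powerset.1 hS hs, mem_cell.2 ⟨hi s hs, hj s hs⟩⟩,
      fun s hs => ⟨hi s hs, hj s hs⟩⟩

/-! ### Sweeping a digitally convex set column by column -/

theorem proj_union {A : Finset (ℤ × ℤ)} {i k l : ℤ} (h1 : i ≤ k) (h2 : k ≤ l) :
    proj A i l = proj A i k ∪ proj A k l := by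
  ext y
  simp only [Finset.mem_union, mem_proj]
  constructor
  · rintro ⟨x, h3, h4, h5⟩
    by_cases h : x < k
    · exact Or.inl ⟨x, h3, h, h5⟩
    · exact Or.inr ⟨x, by omega, h4, h5⟩
  · rintro (⟨x, h3, h4, h5⟩ | ⟨x, h3, h4, h5⟩)
    · exact ⟨x, h3, by omega, h5⟩
    · exact ⟨x, by omega, h4, h5⟩

theorem mem_proj_column {A : Finset (ℤ × ℤ)} {k y : ℤ} : y ∈ proj A k (k + 1) ↔ (k, y) ∈ A := by
  rw [mem_proj]
  constructor
  · rintro ⟨x, h1, h2, h3⟩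
    obtain rfl : x = k := by omega
    exact h3
  · exact fun h => ⟨k, le_rfl, by omega, h⟩

/-- If every column of a digitally convex set `A` is adjacent to one on the side of the
column `k₀`, then the local estimator counts one connected component. -/
theorem sum_ends_eq_one {n : ℤ} (hn : 2 ≤ n) (A : Finset (ℤ × ℤ)) (k₀ : ℤ)
    (h0 : ∃ y, (k₀, y) ∈ A)
    (hcol : ∀ k x y z, (k, x) ∈ A → (k, z) ∈ A → x ≤ y → y ≤ z → (k, y) ∈ A)
    (hR : ∀ k₁ k₂ k p i q, k₁ < k → k₂ < k → (k₁, p) ∈ A → (k₂, q) ∈ A → (k, i) ∈ A →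
      p < i → i < q → (k - 1, i) ∈ A)
    (hL : ∀ k₁ k₂ k p i q, k < k₁ → k < k₂ → (k₁, p) ∈ A → (k₂, q) ∈ A → (k, i) ∈ A →
      p < i → i < q → (k + 1, i) ∈ A)
    (aR : ∀ k y, k₀ < k → (k, y) ∈ A → ∃ k' y' y'', k - n < k' ∧ k₀ ≤ k' ∧ k' < k ∧
      (k', y') ∈ A ∧ (k, y'') ∈ A ∧ |y' - y''| < n)
    (aL : ∀ k y, k < k₀ → (k, y) ∈ A → ∃ k' y' y'', k' < k + n ∧ k' ≤ k₀ ∧ k < k' ∧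
      (k', y') ∈ A ∧ (k, y'') ∈ A ∧ |y' - y''| < n) :
    ∃ J : Finset ℤ, (∀ z ∈ A, z.1 ∈ J) ∧
      ∑ i ∈ J, (((ends n (proj A i (i + n))).card : ℝ)
        - ((ends n (proj A (i + 1) (i + n))).card : ℝ)) = 1 := by
  have hI : ∀ k, ∀ x ∈ proj A k (k + 1), ∀ z ∈ proj A k (k + 1), ∀ y, x ≤ y → y ≤ z →
      y ∈ proj A k (k + 1) := by
    intro k x hx z hz y hxy hyz
    rw [mem_proj_column] at *
    exact hcol k x y z hx hz hxy hyz
  -- Either alternative for `i` ensures that the neighbour column `k'` given by `aR` lies in `[i,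
  -- k)`.
  have attR : ∀ i k, k₀ < k → i < k → (i ≤ k₀ ∨ i ≤ k - n + 1) →
      (ends n (proj A i (k + 1))).card = (ends n (proj A i k)).card := by
    intro i k hk hik hi
    rw [proj_union hik.le (show k ≤ k + 1 by omega)]
    rcases (proj A k (k + 1)).eq_empty_or_nonempty with h | ⟨y, hy⟩
    · rw [h, Finset.union_empty]
    · obtain ⟨k', y', y'', h1, h2, h3, h4, h5, h6⟩ := aR k y hk (mem_proj_column.1 hy)
      refine card_ends_union hn (hI k) ⟨y', mem_proj.2 ⟨k', by omega, h3, h4⟩, y'',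
        mem_proj_column.2 h5, h6⟩ ?_
      intro p hp q hq j hj hpj hjq
      obtain ⟨k₁, -, h7, h8⟩ := mem_proj.1 hp
      obtain ⟨k₂, -, h9, h10⟩ := mem_proj.1 hq
      exact mem_proj.2 ⟨k - 1, by omega, by omega,
        hR k₁ k₂ k p j q h7 h9 h8 h10 (mem_proj_column.1 hj) hpj hjq⟩
  have attL : ∀ k, k < k₀ →
      (ends n (proj A k (k + n))).card = (ends n (proj A (k + 1) (k + n))).card := by
    intro k hk
    rw [proj_union (show k ≤ k + 1 by omega) (show k + 1 ≤ k + n by omega), Finset.union_comm]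
    rcases (proj A k (k + 1)).eq_empty_or_nonempty with h | ⟨y, hy⟩
    · rw [h, Finset.union_empty]
    · obtain ⟨k', y', y'', h1, h2, h3, h4, h5, h6⟩ := aL k y hk (mem_proj_column.1 hy)
      refine card_ends_union hn (hI k) ⟨y', mem_proj.2 ⟨k', by omega, h1, h4⟩, y'',
        mem_proj_column.2 h5, h6⟩ ?_
      intro p hp q hq j hj hpj hjq
      obtain ⟨k₁, h7, -, h8⟩ := mem_proj.1 hp
      obtain ⟨k₂, h9, -, h10⟩ := mem_proj.1 hq
      exact mem_proj.2 ⟨k + 1, by omega, by omega,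
        hL k₁ k₂ k p j q (by omega) (by omega) h8 h10 (mem_proj_column.1 hj) hpj hjq⟩
  have hstart : ∀ m : ℕ, (ends n (proj A k₀ (k₀ + 1 + m))).card = 1 := by
    intro m
    induction m with
    | zero =>
      obtain ⟨y, hy⟩ := h0
      simpa using card_ends_interval hn ⟨y, mem_proj_column.2 hy⟩ (hI k₀)
    | succ m ih =>
      have := attR k₀ (k₀ + 1 + m) (by omega) (by omega) (Or.inl le_rfl)
      push_cast
      rw [← add_assoc, this, ih]
  have hstart' : (ends n (proj A k₀ (k₀ + n - 1))).card = 1 := by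
    have := hstart (n - 2).toNat
    rwa [show k₀ + 1 + ((n - 2).toNat : ℤ) = k₀ + n - 1 by omega] at this
  obtain ⟨M, hM⟩ : ∃ M : ℤ, ∀ z ∈ A, k₀ - M ≤ z.1 ∧ z.1 < k₀ + M := by
    refine ⟨∑ z ∈ A, (|z.1 - k₀| + 1), fun z hz => ?_⟩
    have h := Finset.single_le_sum (f := fun z : ℤ × ℤ => |z.1 - k₀| + 1)
      (fun i _ => by positivity) hz
    have h1 := le_abs_self (z.1 - k₀)
    have h2 := neg_abs_le (z.1 - k₀)
    omega
  have hM0 : 0 ≤ M := by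
    obtain ⟨y, hy⟩ := h0
    have := hM _ hy
    simp only at this
    omega
  -- Columns before `k₀` contribute zero by `attL`. From `k₀` on, `attR` removes the last column of
  -- the wider window, so that the summands telescope.
  have hsum : ∀ m : ℕ, ∑ i ∈ Finset.Ico (k₀ - M) (k₀ + m),
      (((ends n (proj A i (i + n))).card : ℝ) - ((ends n (proj A (i + 1) (i + n))).card : ℝ))
      = 1 - ((ends n (proj A (k₀ + m) (k₀ + m + n - 1))).card : ℝ) := by
    intro m
    induction m with
    | zero =>
      rw [Finset.sum_eq_zero]
      · simp [hstart']
      · intro i hi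
        rw [attL i (by have := (Finset.mem_Ico.1 hi).2; simp at this; omega), sub_self]
    | succ m ih =>
      have hins : Finset.Ico (k₀ - M) (k₀ + (m + 1 : ℕ))
          = insert (k₀ + m) (Finset.Ico (k₀ - M) (k₀ + m)) := by
        ext x
        simp only [Finset.mem_insert, Finset.mem_Ico]
        omega
      rw [hins, Finset.sum_insert (by simp), ih]
      have := attR (k₀ + m) (k₀ + m + n - 1) (by omega) (by omega) (Or.inr (by omega))
      rw [sub_add_cancel] at this
      rw [this, show k₀ + ((m + 1 : ℕ) : ℤ) = k₀ + m + 1 by push_cast; ring,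
        show k₀ + (m : ℤ) + 1 + n - 1 = k₀ + m + n by ring]
      ring
  refine ⟨Finset.Ico (k₀ - M) (k₀ + M), fun z hz => Finset.mem_Ico.2 (hM z hz), ?_⟩
  have h := hsum M.toNat
  rw [Int.toNat_of_nonneg hM0] at h
  rw [h]
  have : proj A (k₀ + M) (k₀ + M + n - 1) = ∅ := by
    refine Finset.eq_empty_of_forall_notMem fun y hy => ?_
    obtain ⟨x, h1, -, h2⟩ := mem_proj.1 hy
    have := hM _ h2
    simp only at this
    omega
  rw [this]
  simp [ends]

/-! ### Chords of planar convex sets -/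

theorem convex_combination_mem {C : Set (ℝ × ℝ)} (hC : Convex ℝ C) {x₁ y₁ x₂ y₂ t x y : ℝ}
    (h₁ : (x₁, y₁) ∈ C) (h₂ : (x₂, y₂) ∈ C) (h0 : 0 ≤ t) (h1 : t ≤ 1)
    (hx : x = (1 - t) * x₁ + t * x₂) (hy : y = (1 - t) * y₁ + t * y₂) : (x, y) ∈ C := by
  have := hC h₁ h₂ (sub_nonneg.2 h1) h0 (sub_add_cancel 1 t)
  simpa [hx, hy] using this

theorem mem_column_of_le {C : Set (ℝ × ℝ)} (hC : Convex ℝ C) {x y₁ y₂ y : ℝ}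
    (h₁ : (x, y₁) ∈ C) (h₂ : (x, y₂) ∈ C) (hy₁ : y₁ ≤ y) (hy₂ : y ≤ y₂) : (x, y) ∈ C := by
  rcases hy₁.eq_or_lt with rfl | h
  · exact h₁
  · have hpos : 0 < y₂ - y₁ := by linarith
    refine convex_combination_mem hC h₁ h₂ (t := (y - y₁) / (y₂ - y₁)) (by
      apply div_nonneg <;> linarith) ((div_le_one hpos).2 (by linarith)) (by ring) ?_
    field_simp
    ring

theorem mem_row_of_le {C : Set (ℝ × ℝ)} (hC : Convex ℝ C) {y x₁ x₂ x : ℝ}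
    (h₁ : (x₁, y) ∈ C) (h₂ : (x₂, y) ∈ C) (hx₁ : x₁ ≤ x) (hx₂ : x ≤ x₂) : (x, y) ∈ C := by
  rcases hx₁.eq_or_lt with rfl | h
  · exact h₁
  · have hpos : 0 < x₂ - x₁ := by linarith
    refine convex_combination_mem hC h₁ h₂ (t := (x - x₁) / (x₂ - x₁)) (by
      apply div_nonneg <;> linarith) ((div_le_one hpos).2 (by linarith)) ?_ (by ring)
    field_simp
    ring

/-- The level sets of `L` are the lines parallel to `d`. The point `m p` on the line through `p₀ + t
• d` and `q` lies on the level of `p`, so `m p = p + τ p • d`, and `τ p` tends to `t` as `p` tends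
to `p₀`. -/
theorem eventually_add_smul_mem_aux {C : Set (ℝ × ℝ)} (hC : Convex ℝ C) {p₀ d q : ℝ × ℝ} {t : ℝ}
    (hd : d ≠ 0) (ht : 0 < t) (h : p₀ + t • d ∈ C) (hq : q ∈ C) (L : ℝ × ℝ → ℝ)
    (hL : ∀ p, L p = d.1 * (p.2 - p₀.2) - d.2 * (p.1 - p₀.1)) :
    ∀ᶠ p in 𝓝 p₀, p ∈ C → 0 ≤ L p / L q → L p / L q * L q = L p → p + (t / 2) • d ∈ C := by
  have hdd : 0 < d.1 ^ 2 + d.2 ^ 2 := by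
    by_contra hc
    apply hd
    ext <;> simp <;> nlinarith [sq_nonneg d.1, sq_nonneg d.2]
  set m : ℝ × ℝ → ℝ × ℝ := fun p => (1 - L p / L q) • (p₀ + t • d) + (L p / L q) • q
  set τ : ℝ × ℝ → ℝ := fun p =>
    (((m p).1 - p.1) * d.1 + ((m p).2 - p.2) * d.2) / (d.1 ^ 2 + d.2 ^ 2)
  have hLc : Continuous L := by
    rw [funext hL]
    fun_prop
  have hmc : Continuous m := by fun_prop
  have hτc : Continuous τ := by fun_prop
  have hL0 : L p₀ = 0 := by simp [hL]
  have hτ0 : τ p₀ = t := by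
    simp only [τ, m, hL0]
    simp
    field_simp
  have e1 : ∀ᶠ p in 𝓝 p₀, t / 2 < τ p :=
    hτc.continuousAt.eventually_const_lt (by rw [hτ0]; linarith)
  have e2 : ∀ᶠ p in 𝓝 p₀, L p / L q < 1 :=
    (hLc.div_const (L q)).continuousAt.eventually_lt_const (by simp [hL0])
  filter_upwards [e1, e2] with p h1 h2 hp h3 h4
  have hm : m p ∈ C := hC h hq (by linarith) h3 (by ring)
  have hcross : d.1 * ((m p).2 - p.2) - d.2 * ((m p).1 - p.1) = 0 := by
    set r := L p / L q
    have hm1 : (m p).1 = (1 - r) * (p₀.1 + t * d.1) + r * q.1 := by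
      simp only [m, r, Prod.fst_add, Prod.smul_fst, smul_eq_mul]
    have hm2 : (m p).2 = (1 - r) * (p₀.2 + t * d.2) + r * q.2 := by
      simp only [m, r, Prod.snd_add, Prod.smul_snd, smul_eq_mul]
    rw [hL q, hL p] at h4
    rw [hm1, hm2]
    linear_combination h4
  have hp1 : (m p).1 = p.1 + τ p * d.1 := by
    simp only [τ]
    field_simp
    linear_combination (-d.2) * hcross
  have hp2 : (m p).2 = p.2 + τ p * d.2 := by
    simp only [τ]
    field_simp
    linear_combination d.1 * hcross
  have hτpos : 0 < τ p := by linarith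
  have key := hC hp hm (a := 1 - t / 2 / τ p) (b := t / 2 / τ p)
    (sub_nonneg.2 ((div_le_one hτpos).2 h1.le)) (by positivity) (by ring)
  convert key using 1
  ext
  · simp only [Prod.fst_add, Prod.smul_fst, smul_eq_mul, hp1]
    field_simp
    ring
  · simp only [Prod.snd_add, Prod.smul_snd, smul_eq_mul, hp2]
    field_simp
    ring

/-- In a planar convex set, the length of chords in a fixed direction is lower semicontinuous. -/
theorem eventually_add_smul_mem {C : Set (ℝ × ℝ)} (hC : Convex ℝ C) {p₀ d : ℝ × ℝ} {t : ℝ}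
    (hp₀ : p₀ ∈ C) (hd : d ≠ 0) (ht : 0 < t) (h : p₀ + t • d ∈ C) :
    ∀ᶠ p in 𝓝 p₀, p ∈ C → p + (t / 2) • d ∈ C := by
  set L : ℝ × ℝ → ℝ := fun p => d.1 * (p.2 - p₀.2) - d.2 * (p.1 - p₀.1)
  have aux := fun q hq => eventually_add_smul_mem_aux hC hd ht h (q := q) hq L fun _ => rfl
  -- For `q = p₀` the divisor `L q` is zero and so is the quotient; this covers the points `p` with
  -- `L p = 0`.
  have e0 := aux p₀ hp₀
  have e1 : ∀ᶠ p in 𝓝 p₀, p ∈ C → 0 < L p → p + (t / 2) • d ∈ C := by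
    by_cases hq : ∃ q ∈ C, 0 < L q
    · obtain ⟨q, hq, hLq⟩ := hq
      filter_upwards [aux q hq] with p h1 h2 h3
      exact h1 h2 (by positivity) (div_mul_cancel₀ _ hLq.ne')
    · exact Eventually.of_forall fun p h1 h2 => absurd ⟨p, h1, h2⟩ hq
  have e2 : ∀ᶠ p in 𝓝 p₀, p ∈ C → L p < 0 → p + (t / 2) • d ∈ C := by
    by_cases hq : ∃ q ∈ C, L q < 0
    · obtain ⟨q, hq, hLq⟩ := hq
      filter_upwards [aux q hq] with p h1 h2 h3
      exact h1 h2 (div_nonneg_of_nonpos h3.le hLq.le) (div_mul_cancel₀ _ hLq.ne)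
    · exact Eventually.of_forall fun p h1 h2 => absurd ⟨p, h1, h2⟩ hq
  filter_upwards [e0, e1, e2] with p h0 h1 h2 hp
  rcases lt_trichotomy (L p) 0 with h3 | h3 | h3
  · exact h2 hp h3
  · exact h0 hp (by simp [h3]) (by simp [h3])
  · exact h1 hp h3

theorem add_smul_mem_of_le {E : Type*} [AddCommGroup E] [Module ℝ E] {C : Set E}
    (hC : Convex ℝ C) {p d : E} {s t : ℝ} (hp : p ∈ C) (hs : 0 ≤ s) (hst : s ≤ t)
    (h : p + t • d ∈ C) : p + s • d ∈ C := by
  rcases hs.eq_or_lt with rfl | hs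
  · simpa using hp
  · have ht : 0 < t := hs.trans_le hst
    have := hC.add_smul_mem hp h (t := s / t) ⟨by positivity, (div_le_one ht).2 hst⟩
    rwa [smul_smul, div_mul_cancel₀ _ ht.ne'] at this

/-- If from every point of a planar convex body some direction from `D` leads into the body, then
it does so for a uniform length. -/
theorem exists_uniform_step {C : Set (ℝ × ℝ)} (hcomp : IsCompact C) (hC : Convex ℝ C)
    (D : Set (ℝ × ℝ)) (hD : ∀ p ∈ C, ∃ d ∈ D, d ≠ 0 ∧ ∃ t : ℝ, 0 < t ∧ p + t • d ∈ C) :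
    ∃ ε : ℝ, 0 < ε ∧ ∀ p ∈ C, ∃ d ∈ D, d ≠ 0 ∧ p + ε • d ∈ C := by
  have key : ∃ ε : ℝ, 0 < ε ∧ ∀ p ∈ C, p ∈ C → ∃ d ∈ D, d ≠ 0 ∧ p + ε • d ∈ C := by
    refine hcomp.induction_on
      (p := fun S => ∃ ε : ℝ, 0 < ε ∧ ∀ p ∈ S, p ∈ C → ∃ d ∈ D, d ≠ 0 ∧ p + ε • d ∈ C)
      ⟨1, one_pos, by simp⟩ ?_ ?_ ?_
    · rintro s t hst ⟨ε, hε, h⟩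
      exact ⟨ε, hε, fun p hp => h p (hst hp)⟩
    · rintro s t ⟨ε, hε, h⟩ ⟨ε', hε', h'⟩
      refine ⟨min ε ε', lt_min hε hε', ?_⟩
      rintro p (hp | hp) hpC
      · obtain ⟨d, hd, hd0, hpd⟩ := h p hp hpC
        exact ⟨d, hd, hd0, add_smul_mem_of_le hC hpC (lt_min hε hε').le (min_le_left _ _) hpd⟩
      · obtain ⟨d, hd, hd0, hpd⟩ := h' p hp hpC
        exact ⟨d, hd, hd0, add_smul_mem_of_le hC hpC (lt_min hε hε').le (min_le_right _ _) hpd⟩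
    · intro p₀ hp₀
      obtain ⟨d, hd, hd0, t, ht, hpd⟩ := hD p₀ hp₀
      exact ⟨_, mem_nhdsWithin_of_mem_nhds (eventually_add_smul_mem hC hp₀ hd0 ht hpd), t / 2,
        half_pos ht, fun p h hp => ⟨d, hd, hd0, h hp⟩⟩
  obtain ⟨ε, hε, h⟩ := key
  exact ⟨ε, hε, fun p hp => h p hp hp⟩

/-! ### Neighbouring columns on a fine lattice -/

/-- A step along the column is itself long enough. For a step away from `w`, the column cuts the
triangle spanned by its end point and the vertical segment of length `2 * ρ` centred at `w` in
length `2 * ρ * l`. The hypothesis `h₂` treats the worst case `d.1 = 1`, `x - w.1 = R`. -/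
theorem exists_long_column {C : Set (ℝ × ℝ)} (hC : Convex ℝ C) {w : ℝ × ℝ} {ρ R ε h x y : ℝ}
    (hρ : 0 < ρ) (hε : 0 < ε) (hh : 0 < h)
    (hbox : ∀ x y, |x - w.1| ≤ ρ → |y - w.2| ≤ ρ → (x, y) ∈ C)
    (hbd : ∀ p ∈ C, |p.1 - w.1| ≤ R ∧ |p.2 - w.2| ≤ R)
    (h₁ : h ≤ ε) (h₂ : h * (ε + R) ≤ 2 * ρ * ε) (hx : w.1 < x) (hp : (x, y) ∈ C)
    {d : ℤ × ℤ} (hd0 : d ≠ 0) (hd1 : 0 ≤ d.1) (hd : (x + ε * d.1, y + ε * d.2) ∈ C) :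
    ∃ s, (x, s) ∈ C ∧ (x, s + h) ∈ C := by
  have hxR : x - w.1 ≤ R := (le_abs_self _).trans (hbd _ hp).1
  have main : ∀ s₁ s₂, (x, s₁) ∈ C → (x, s₂) ∈ C → s₁ + h ≤ s₂ → ∃ s, (x, s) ∈ C ∧ (x, s + h) ∈ C :=
    fun s₁ s₂ hs₁ hs₂ hle =>
      ⟨s₁, hs₁, mem_column_of_le hC hs₁ hs₂ (by linarith) hle⟩
  rcases hd1.eq_or_lt with h0 | h0
  · rw [← h0] at hd
    simp only [Int.cast_zero, mul_zero, add_zero] at hd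
    have hd2 : d.2 ≠ 0 := fun h2 => hd0 (Prod.ext h0.symm h2)
    rcases lt_or_gt_of_ne hd2 with h2 | h2
    · have : (d.2 : ℝ) ≤ -1 := by exact_mod_cast (show d.2 ≤ -1 by omega)
      exact main _ _ hd hp (by nlinarith)
    · have : (1 : ℝ) ≤ d.2 := by exact_mod_cast (show 1 ≤ d.2 by omega)
      exact main _ _ hp hd (by nlinarith)
  · have hd1' : (1 : ℝ) ≤ d.1 := by exact_mod_cast (show 1 ≤ d.1 by omega)
    have hden : 0 < ε * d.1 + (x - w.1) := by nlinarith
    set l := ε * d.1 / (ε * d.1 + (x - w.1)) with hl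
    have hl0 : 0 ≤ l := by positivity
    have hl1 : l ≤ 1 := (div_le_one hden).2 (by linarith)
    have hlx : x = (1 - l) * (x + ε * d.1) + l * w.1 := by
      rw [hl]
      field_simp
      ring
    have hm : (x, (1 - l) * (y + ε * d.2) + l * (w.2 - ρ)) ∈ C :=
      convex_combination_mem hC hd (hbox w.1 (w.2 - ρ) (by simpa using hρ.le)
        (by simp [abs_of_pos hρ])) hl0 hl1 hlx rfl
    have hp : (x, (1 - l) * (y + ε * d.2) + l * (w.2 + ρ)) ∈ C :=
      convex_combination_mem hC hd (hbox w.1 (w.2 + ρ) (by simpa using hρ.le)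
        (by simp [abs_of_pos hρ])) hl0 hl1 hlx rfl
    refine main _ _ hm hp ?_
    have : h ≤ 2 * ρ * l := by
      rw [hl, ← mul_div_assoc, le_div_iff₀ hden]
      nlinarith [mul_le_mul_of_nonneg_right h₂ (by linarith : (0 : ℝ) ≤ d.1),
        mul_nonneg hh.le (sub_nonneg.2 hxR), mul_nonneg hh.le (by linarith : 0 ≤ R),
        mul_nonneg (mul_nonneg hh.le (by linarith : 0 ≤ R)) (sub_nonneg.2 hd1')]
    linarith

theorem exists_int_mul_mem {a c s t : ℝ} (ha : 0 < a) (h : s + a ≤ t) :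
    ∃ m : ℤ, s ≤ a * (m + c) ∧ a * (m + c) ≤ t := by
  refine ⟨⌈s / a - c⌉, ?_, ?_⟩
  · have := Int.le_ceil (s / a - c)
    have h1 : s / a ≤ ⌈s / a - c⌉ + c := by linarith
    rw [div_le_iff₀ ha] at h1
    linarith
  · have := Int.ceil_lt_add_one (s / a - c)
    have h1 : ⌈s / a - c⌉ + c ≤ (s + a) / a := by
      rw [add_div, div_self ha.ne']
      linarith
    rw [le_div_iff₀ ha] at h1
    linarith

/-- Near `w` the box supplies a common row with the preceding column. Further out, a step towards
`w` is scaled down from `ε` to `a` and leads to a lattice point less than `n` away in each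
coordinate; any other step makes the column long. -/
theorem exists_adjacent_column {C : Set (ℝ × ℝ)} (hC : Convex ℝ C) {n : ℕ} (hn : 2 ≤ n)
    {w : ℝ × ℝ} {ρ R ε h a c₁ c₂ : ℝ} (hρ : 0 < ρ) (hε : 0 < ε) (hh : 0 < h) (ha : 0 < a)
    (hbox : ∀ x y, |x - w.1| ≤ ρ → |y - w.2| ≤ ρ → (x, y) ∈ C)
    (hbd : ∀ p ∈ C, |p.1 - w.1| ≤ R ∧ |p.2 - w.2| ≤ R)
    (hstep : ∀ x y, (x, y) ∈ C → ∃ d ∈ differenceCell n, d ≠ 0 ∧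
      (x + ε * (d.1 : ℝ), y + ε * (d.2 : ℝ)) ∈ C)
    (h₁ : h ≤ ε) (h₂ : h * (ε + R) ≤ 2 * ρ * ε) (ha₁ : a ≤ ε) (ha₂ : a * (n + 2) ≤ ρ)
    (ha₃ : a * (ρ + 2 * R) ≤ h * ρ) {k₀ : ℤ} (hk₀ : |a * (k₀ + c₁) - w.1| ≤ a)
    {k y : ℤ} (hk : k₀ < k) (hy : (a * (k + c₁), a * (y + c₂)) ∈ C) :
    ∃ k' y' y'' : ℤ, k - n < k' ∧ k₀ ≤ k' ∧ k' < k ∧ (a * (k' + c₁), a * (y' + c₂)) ∈ C ∧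
      (a * (k + c₁), a * (y'' + c₂)) ∈ C ∧ |y' - y''| < n := by
  have hkk : (k₀ : ℝ) + 1 ≤ k := by exact_mod_cast hk
  have hn' : (2 : ℝ) ≤ n := by exact_mod_cast hn
  rw [abs_le] at hk₀
  have hx1 : w.1 ≤ a * (k + c₁) := by nlinarith
  have haρ : 4 * a ≤ ρ := by nlinarith
  -- two adjacent lattice points in the same row
  have row : ∀ m : ℤ, (a * (k + c₁), a * (m + c₂)) ∈ C → (a * (k + c₁) - a, a * (m + c₂)) ∈ C →
      ∃ k' y' y'' : ℤ, k - n < k' ∧ k₀ ≤ k' ∧ k' < k ∧ (a * (k' + c₁), a * (y' + c₂)) ∈ C ∧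
      (a * (k + c₁), a * (y'' + c₂)) ∈ C ∧ |y' - y''| < n := by
    intro m hm hm'
    refine ⟨k - 1, m, m, by omega, by omega, by omega, ?_, hm, by simp; omega⟩
    have : a * (((k - 1 : ℤ) : ℝ) + c₁) = a * (k + c₁) - a := by push_cast; ring
    rwa [this]
  by_cases hc : a * (k + c₁) ≤ w.1 + ρ
  · obtain ⟨m, hm1, hm2⟩ := exists_int_mul_mem (c := c₂) (s := w.2 - a) (t := w.2) ha (by linarith)
    refine row m (hbox _ _ ?_ ?_) (hbox _ _ ?_ ?_) <;> rw [abs_le] <;> constructor <;> linarith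
  · push Not at hc
    obtain ⟨d, hd, hd0, hdC⟩ := hstep _ _ hy
    simp only [differenceCell, Finset.mem_product, Finset.mem_Ioo] at hd
    by_cases hd1 : d.1 < 0
    · have hd1' : (d.1 : ℝ) ≤ -1 := by exact_mod_cast (show d.1 ≤ -1 by omega)
      have hdn : -(n : ℝ) < d.1 := by exact_mod_cast hd.1.1
      -- The column is more than `ρ` beyond `w`, so by `ha₂` a jump of fewer than `n` columns cannot
      -- pass `k₀`.
      have hfar : (n : ℝ) < k - k₀ := by
        by_contra hcon
        push Not at hcon
        nlinarith [mul_le_mul_of_nonneg_left hcon ha.le]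
      have hfar' : (n : ℤ) < k - k₀ := by exact_mod_cast hfar
      refine ⟨k + d.1, y + d.2, y, by omega, by omega, by omega, ?_, hy, ?_⟩
      · have := add_smul_mem_of_le hC (d := ((d.1 : ℝ), (d.2 : ℝ))) hy ha.le ha₁ (by simpa using hdC)
        simp only [Prod.smul_mk, Prod.mk_add_mk, smul_eq_mul] at this
        push_cast
        convert this using 2 <;> ring
      · rw [add_sub_cancel_left, abs_lt]
        exact hd.2
    · have hx2 : w.1 < a * (k + c₁) := by linarith
      obtain ⟨s, hs, hs'⟩ := exists_long_column hC hρ hε hh hbox hbd h₁ h₂ hx2 hy hd0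
        (not_lt.1 hd1) hdC
      set x := a * (k + c₁) with hx
      -- Contracting by `τ` towards `w` moves the column to its neighbour at `x - a` and shifts
      -- heights by at most `τ * R ≤ a * R / ρ`. By `ha₃` the two segments overlap in length at
      -- least `a`, which is room for a lattice row.
      set τ := a / (x - w.1) with hτ
      have hxw : 0 < x - w.1 := by linarith
      have hτ0 : 0 ≤ τ := by positivity
      have hτρ : τ * ρ ≤ a := by
        rw [hτ, div_mul_eq_mul_div, div_le_iff₀ hxw]
        nlinarith
      have hτ1 : τ ≤ 1 := (div_le_one hxw).2 (by linarith)
      have hxτ : x - a = (1 - τ) * x + τ * w.1 := by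
        rw [hτ]
        field_simp
        ring
      have hwC : (w.1, w.2) ∈ C := hbox _ _ (by simpa using hρ.le) (by simpa using hρ.le)
      have hs1 := convex_combination_mem hC hs hwC hτ0 hτ1 hxτ rfl
      have hs1' := convex_combination_mem hC hs' hwC hτ0 hτ1 hxτ rfl
      have hb := abs_le.1 (hbd _ hs).2
      have hb' := abs_le.1 (hbd _ hs').2
      simp only at hb hb'
      have hR0 : 0 ≤ R := (abs_nonneg _).trans (hbd _ hs).2
      have hτR : τ * R * ρ ≤ a * R := by nlinarith
      obtain ⟨m, hm1, hm2⟩ := exists_int_mul_mem (c := c₂) (s := s + τ * R) (t := s + h - τ * R) ha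
        (by
          by_contra hcon
          push Not at hcon
          nlinarith)
      have hτR0 : 0 ≤ τ * R := by positivity
      refine row m (mem_column_of_le hC hs hs' ?_ ?_) (mem_column_of_le hC hs1 hs1' ?_ ?_)
      · linarith
      · linarith
      · nlinarith
      · nlinarith

/-! ### Transfer to coordinates and proof of part (i) -/

/-- The set of coordinates of the points of `K` with respect to the basis `ξ`. -/
def coordSet (ξ : Module.Basis (Fin 2) ℝ Plane) (K : Set Plane) : Set (ℝ × ℝ) :=
  {p | p.1 • ξ 0 + p.2 • ξ 1 ∈ K}

theorem sum_repr_eq (ξ : Module.Basis (Fin 2) ℝ Plane) (x : Plane) :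
    ξ.repr x 0 • ξ 0 + ξ.repr x 1 • ξ 1 = x := by
  have := ξ.sum_repr x
  rwa [Fin.sum_univ_two] at this

theorem coordSet_eq_image (ξ : Module.Basis (Fin 2) ℝ Plane) (K : Set Plane) :
    coordSet ξ K = (fun x => (ξ.repr x 0, ξ.repr x 1)) '' K := by
  ext p
  constructor
  · intro hp
    refine ⟨_, hp, ?_⟩
    simp
  · rintro ⟨x, hx, rfl⟩
    simpa only [coordSet, Set.mem_ofPred_eq, sum_repr_eq] using hx

theorem continuous_coord (ξ : Module.Basis (Fin 2) ℝ Plane) (i : Fin 2) :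
    Continuous fun x => ξ.repr x i :=
  (ξ.coord i).continuous_of_finiteDimensional

theorem isCompact_coordSet (ξ : Module.Basis (Fin 2) ℝ Plane) {K : Set Plane} (hK : IsCompact K) :
    IsCompact (coordSet ξ K) := by
  rw [coordSet_eq_image]
  exact hK.image ((continuous_coord ξ 0).prodMk (continuous_coord ξ 1))

theorem convex_coordSet (ξ : Module.Basis (Fin 2) ℝ Plane) {K : Set Plane} (hK : Convex ℝ K) :
    Convex ℝ (coordSet ξ K) := by
  intro p hp q hq a b ha hb hab
  have := hK hp hq ha hb hab
  simp only [coordSet, Set.mem_ofPred_eq]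
  convert this using 1
  simp only [Prod.fst_add, Prod.snd_add, Prod.smul_fst, Prod.smul_snd, smul_eq_mul]
  module

theorem exists_box_subset (ξ : Module.Basis (Fin 2) ℝ Plane) {K : Set Plane} {x : Plane}
    (hx : x ∈ interior K) : ∃ ρ : ℝ, 0 < ρ ∧ ∀ s t : ℝ, |s - ξ.repr x 0| ≤ ρ →
      |t - ξ.repr x 1| ≤ ρ → (s, t) ∈ coordSet ξ K := by
  have hc : Continuous fun p : ℝ × ℝ => p.1 • ξ 0 + p.2 • ξ 1 := by fun_prop
  have hmem : (fun p : ℝ × ℝ => p.1 • ξ 0 + p.2 • ξ 1) ⁻¹' interior K ∈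
      𝓝 (ξ.repr x 0, ξ.repr x 1) :=
    hc.continuousAt.preimage_mem_nhds (isOpen_interior.mem_nhds (by simpa only [sum_repr_eq]))
  obtain ⟨r, hr, h⟩ := Metric.nhds_basis_closedBall.mem_iff.1 hmem
  refine ⟨r, hr, fun s t hs ht => ?_⟩
  have hst : (s, t) ∈ Metric.closedBall (ξ.repr x 0, ξ.repr x 1) r := ?_
  · exact interior_subset (s := K) (h hst)
  rw [Metric.mem_closedBall, Prod.dist_eq]
  exact max_le hs ht

theorem gridPoint_mem_iff (ξ : Module.Basis (Fin 2) ℝ Plane) (a : ℝ) (c : Plane) (z : ℤ × ℤ)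
    (K : Set Plane) : gridPoint ξ a c z ∈ K ↔
      (a * (z.1 + ξ.repr c 0), a * (z.2 + ξ.repr c 1)) ∈ coordSet ξ K := by
  have : gridPoint ξ a c z
      = (a * (z.1 + ξ.repr c 0)) • ξ 0 + (a * (z.2 + ξ.repr c 1)) • ξ 1 := by
    rw [gridPoint, latticePoint]
    conv_lhs => rw [← sum_repr_eq ξ c]
    module
  rw [this]
  rfl

/-- This rules out `n = 1` in part (i), where the chain arguments, which need `n ≥ 2`, would fail.
-/
theorem isCritical_one (ξ : Module.Basis (Fin 2) ℝ Plane) {K : Set Plane} (hK : IsClosed K)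
    {x : Plane} (hx : x ∈ frontier K) : IsCritical 1 ξ K x := by
  refine ⟨hx, fun a ha => ?_⟩
  have : differenceCell 1 = {0} := by decide
  rw [this]
  simp only [Finset.coe_singleton, Set.image_singleton, latticePoint, Prod.fst_zero, Int.cast_zero,
    zero_smul, Prod.snd_zero, add_zero, smul_zero]
  exact Set.inter_eq_right.2 (Set.singleton_subset_iff.2 ⟨x, hK.frontier_subset hx, sub_self x⟩)

/-- At a point which is not critical, some direction of the difference cell leads into `K`. -/
theorem exists_add_smul_mem {n : ℕ} (hn : 2 ≤ n) (ξ : Module.Basis (Fin 2) ℝ Plane) {K : Set Plane}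
    {x : Plane} (hx : x ∈ K) (hcrit : ¬ IsCritical n ξ K x) :
    ∃ d ∈ differenceCell n, d ≠ 0 ∧ ∃ t : ℝ, 0 < t ∧ x + t • latticePoint ξ d ∈ K := by
  by_cases hi : x ∈ interior K
  · have hc : Continuous fun t : ℝ => x + t • latticePoint ξ (1, 0) := by fun_prop
    have h0 : ∀ᶠ t in 𝓝 (0 : ℝ), x + t • latticePoint ξ (1, 0) ∈ interior K :=
      hc.continuousAt.preimage_mem_nhds (isOpen_interior.mem_nhds (by simpa using hi))
    have : ∀ᶠ t in 𝓝[>] (0 : ℝ), x + t • latticePoint ξ (1, 0) ∈ K :=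
      (h0.mono fun _ h => interior_subset h).filter_mono nhdsWithin_le_nhds
    obtain ⟨t, h1, h2⟩ := (this.and self_mem_nhdsWithin).exists
    refine ⟨(1, 0), ?_, by simp, t, h2, h1⟩
    simp [differenceCell]
    omega
  · have hfr : x ∈ frontier K := ⟨subset_closure hx, hi⟩
    simp only [IsCritical, hfr, true_and] at hcrit
    push Not at hcrit
    obtain ⟨a, ha, hne⟩ := hcrit
    by_contra hcon
    push Not at hcon
    refine hne (Set.Subset.antisymm ?_ ?_)
    · rintro y ⟨⟨u, hu, rfl⟩, d, hd, hy⟩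
      simp only at hy
      by_contra h0
      refine hcon d hd ?_ a ha (by rw [hy]; simpa using hu)
      rintro rfl
      apply h0
      simp [← hy, latticePoint]
    · rintro y rfl
      refine ⟨⟨x, hx, sub_self x⟩, 0, ?_, by simp [latticePoint]⟩
      simp [differenceCell]
      omega

theorem localEuler_eq_one (ξ : Module.Basis (Fin 2) ℝ Plane) {n : ℕ} (hn : 0 < n) {K : Set Plane}
    (hK : K ∈ convexBodies) (hcrit : ∀ x, ¬ IsCritical n ξ K x) :
    ∃ δ : ℝ, 0 < δ ∧ ∀ a : ℝ, 0 < a → a < δ → ∀ c : Plane, localEuler n ξ a c K = 1 := by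
  obtain ⟨hcomp, hconv, w', hw'⟩ := hK
  have hn2 : 2 ≤ n := by
    by_contra h
    obtain rfl : n = 1 := by omega
    have hfr : (frontier K).Nonempty := by
      rw [Set.nonempty_iff_ne_empty, Ne, frontier_eq_empty_iff]
      rintro (rfl | rfl)
      · simp at hw'
      · exact noncompact_univ Plane hcomp
    exact hcrit _ (isCritical_one ξ hcomp.isClosed hfr.choose_spec)
  set C := coordSet ξ K with hCdef
  have hC : Convex ℝ C := convex_coordSet ξ hconv
  have hCc : IsCompact C := isCompact_coordSet ξ hcomp
  obtain ⟨ρ, hρ, hbox⟩ := exists_box_subset ξ hw'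
  set w : ℝ × ℝ := (ξ.repr w' 0, ξ.repr w' 1) with hw
  obtain ⟨R, hR, hbd⟩ : ∃ R, 0 ≤ R ∧ ∀ p ∈ C, |p.1 - w.1| ≤ R ∧ |p.2 - w.2| ≤ R := by
    obtain ⟨R, hR⟩ := hCc.isBounded.subset_closedBall w
    have h : ∀ p ∈ C, |p.1 - w.1| ≤ R ∧ |p.2 - w.2| ≤ R := fun p hp => by
      have := hR hp
      rw [Metric.mem_closedBall, Prod.dist_eq, max_le_iff] at this
      exact this
    refine ⟨R, (abs_nonneg _).trans (h w (hbox _ _ ?_ ?_)).1, h⟩ <;> simpa using hρ.le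
  obtain ⟨ε, hε, hstep'⟩ := exists_uniform_step hCc hC
    ((fun d : ℤ × ℤ => ((d.1 : ℝ), (d.2 : ℝ))) '' (differenceCell n : Set (ℤ × ℤ))) (by
      intro p hp
      obtain ⟨d, hd, hd0, t, ht, h⟩ := exists_add_smul_mem hn2 ξ hp (hcrit _)
      refine ⟨_, ⟨d, hd, rfl⟩, ?_, t, ht, ?_⟩
      · intro h0
        apply hd0
        simpa [Prod.ext_iff] using h0
      · simp only [hCdef, coordSet, Set.mem_ofPred_eq, Prod.fst_add, Prod.snd_add, Prod.smul_fst,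
          Prod.smul_snd, smul_eq_mul]
        convert h using 1
        rw [latticePoint]
        module)
  have hstep : ∀ x y, (x, y) ∈ C → ∃ d ∈ differenceCell n, d ≠ 0 ∧
      (x + ε * (d.1 : ℝ), y + ε * (d.2 : ℝ)) ∈ C := by
    intro x y hxy
    obtain ⟨-, ⟨d, hd, rfl⟩, hd0, h⟩ := hstep' _ hxy
    refine ⟨d, hd, ?_, by simpa using h⟩
    rintro rfl
    simp at hd0
  obtain ⟨h, hh, h₁, h₂⟩ : ∃ h, 0 < h ∧ h ≤ ε ∧ h * (ε + R) ≤ 2 * ρ * ε := by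
    refine ⟨min ε (2 * ρ * ε / (ε + R)), lt_min hε (by positivity), min_le_left _ _, ?_⟩
    rw [← le_div_iff₀ (by positivity)]
    exact min_le_right _ _
  -- The three terms provide the hypotheses `ha₁`, `ha₂`, `ha₃` of `exists_adjacent_column`.
  refine ⟨min ε (min (ρ / (n + 2)) (h * ρ / (ρ + 2 * R))),
    lt_min hε (lt_min (by positivity) (by positivity)), fun a ha haδ c => ?_⟩
  rw [lt_min_iff, lt_min_iff, lt_div_iff₀ (by positivity), lt_div_iff₀ (by positivity)] at haδ
  obtain ⟨ha₁, ha₂, ha₃⟩ := haδ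
  set c₁ := ξ.repr c 0
  set c₂ := ξ.repr c 1
  have hmem : ∀ z : ℤ × ℤ, gridPoint ξ a c z ∈ K ↔ (a * (z.1 + c₁), a * (z.2 + c₂)) ∈ C :=
    fun z => gridPoint_mem_iff ξ a c z K
  have hfin : {z : ℤ × ℤ | gridPoint ξ a c z ∈ K}.Finite := by
    have hint : ∀ (v e : ℝ) (z : ℤ), |a * (z + e) - v| ≤ R →
        z ∈ Set.Icc (⌈(v - R) / a - e⌉) (⌊(v + R) / a - e⌋) := by
      intro v e z hz
      rw [abs_le] at hz
      rw [Set.mem_Icc, Int.ceil_le, Int.le_floor, sub_le_iff_le_add, le_sub_iff_add_le,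
        div_le_iff₀ ha, le_div_iff₀ ha]
      constructor <;> linarith
    refine ((Set.finite_Icc ⌈(w.1 - R) / a - c₁⌉ ⌊(w.1 + R) / a - c₁⌋).prod
      (Set.finite_Icc ⌈(w.2 - R) / a - c₂⌉ ⌊(w.2 + R) / a - c₂⌋)).subset fun z hz => ?_
    have := hbd _ ((hmem z).1 hz)
    exact ⟨hint w.1 c₁ z.1 this.1, hint w.2 c₂ z.2 this.2⟩
  set A := hfin.toFinset with hAdef
  have hA : ∀ z, z ∈ A ↔ gridPoint ξ a c z ∈ K := fun z => hfin.mem_toFinset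
  have hAC : ∀ k y : ℤ, (k, y) ∈ A ↔ (a * (k + c₁), a * (y + c₂)) ∈ C :=
    fun k y => (hA _).trans (hmem _)
  have hn' : (2 : ℝ) ≤ n := by exact_mod_cast hn2
  have haρ : 4 * a ≤ ρ := by nlinarith
  obtain ⟨k₀, hk1, hk2⟩ := exists_int_mul_mem (c := c₁) (s := w.1 - a) (t := w.1) ha (by linarith)
  have hmono : ∀ {i j : ℤ} (e : ℝ), i ≤ j → a * (i + e) ≤ a * (j + e) := by
    intro i j e hij
    have : (i : ℝ) ≤ j := by exact_mod_cast hij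
    nlinarith
  -- a point of a column on a chord between two points on the same side of the column
  have chord : ∀ x₁ x₂ y₁ y₂ y : ℝ, (x₁, y₁) ∈ C → (x₂, y₂) ∈ C → y₁ ≤ y → y ≤ y₂ →
      ∃ x, (x, y) ∈ C ∧ min x₁ x₂ ≤ x ∧ x ≤ max x₁ x₂ := by
    intro x₁ x₂ y₁ y₂ y h1 h2 h3 h4
    rcases h3.eq_or_lt with rfl | h3
    · exact ⟨x₁, h1, min_le_left _ _, le_max_left _ _⟩
    · have hpos : 0 < y₂ - y₁ := by linarith
      set t := (y - y₁) / (y₂ - y₁)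
      have ht0 : 0 ≤ t := div_nonneg (by linarith) hpos.le
      have ht1 : t ≤ 1 := (div_le_one hpos).2 (by linarith)
      refine ⟨(1 - t) * x₁ + t * x₂, convex_combination_mem hC h1 h2 ht0 ht1 rfl ?_, ?_, ?_⟩
      · simp only [t]
        field_simp
        ring
      · nlinarith [min_le_left x₁ x₂, min_le_right x₁ x₂]
      · nlinarith [le_max_left x₁ x₂, le_max_right x₁ x₂]
  -- Reflection reduces the columns left of `k₀` to those on the right. The two-sided bound `hk₀` in
  -- `exists_adjacent_column` survives it.
  set C' : Set (ℝ × ℝ) := {p | (-p.1, p.2) ∈ C} with hC'def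
  have hC' : Convex ℝ C' := by
    intro p hp q hq s t hs ht hst
    have := hC hp hq hs ht hst
    simp only [hC'def, Set.mem_ofPred_eq]
    convert this using 1
    ext
    · simp only [Prod.fst_add, Prod.smul_fst, smul_eq_mul]
      ring
    · rfl
  suffices hsum : ∃ J : Finset ℤ, (∀ z ∈ A, z.1 ∈ J) ∧
      ∑ i ∈ J, (((ends n (proj A i (i + n))).card : ℝ)
        - ((ends n (proj A (i + 1) (i + n))).card : ℝ)) = 1 by
    obtain ⟨J, hJ, hsum⟩ := hsum
    rw [localEuler_eq_sum_ends n hn ξ a c K A hA J hJ, hsum]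
  refine sum_ends_eq_one (n := n) (by exact_mod_cast hn2) A k₀ ?_ ?_ ?_ ?_ ?_ ?_
  · obtain ⟨m, hm1, hm2⟩ := exists_int_mul_mem (c := c₂) (s := w.2 - a) (t := w.2) ha (by linarith)
    refine ⟨m, (hAC _ _).2 (hbox _ _ ?_ ?_)⟩ <;> rw [abs_le] <;> constructor <;> linarith
  · intro k x y z hx hz hxy hyz
    rw [hAC] at *
    exact mem_column_of_le hC hx hz (hmono _ hxy) (hmono _ hyz)
  · intro k₁ k₂ k p i q hk₁ hk₂ hp hq hi hpi hiq
    rw [hAC] at *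
    obtain ⟨x, hx, -, hx2⟩ := chord _ _ _ _ _ hp hq (hmono c₂ hpi.le) (hmono c₂ hiq.le)
    refine mem_row_of_le hC hx hi (hx2.trans (max_le ?_ ?_)) ?_ <;> exact hmono _ (by omega)
  · intro k₁ k₂ k p i q hk₁ hk₂ hp hq hi hpi hiq
    rw [hAC] at *
    obtain ⟨x, hx, hx2, -⟩ := chord _ _ _ _ _ hp hq (hmono c₂ hpi.le) (hmono c₂ hiq.le)
    refine mem_row_of_le hC hi hx ?_ ((le_min ?_ ?_).trans hx2) <;> exact hmono _ (by omega)
  · intro k y hk hy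
    simp only [hAC] at *
    exact exists_adjacent_column hC hn2 hρ hε hh ha hbox hbd hstep h₁ h₂ ha₁.le ha₂.le ha₃.le
      (abs_le.2 ⟨by linarith, by linarith⟩) hk hy
  · intro k y hk hy
    simp only [hAC] at *
    have hneg : ∀ i j : ℤ, (a * (((-i : ℤ) : ℝ) + -c₁), a * (j + c₂)) ∈ C' ↔
        (a * (i + c₁), a * (j + c₂)) ∈ C := by
      intro i j
      simp only [hC'def, Set.mem_ofPred_eq]
      rw [show -(a * (((-i : ℤ) : ℝ) + -c₁)) = a * (i + c₁) by push_cast; ring]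
    obtain ⟨k', y', y'', h3, h4, h5, h6, h7, h8⟩ := exists_adjacent_column (C := C') hC' hn2
      (w := (-w.1, w.2)) (c₁ := -c₁) (k₀ := -k₀) (k := -k) hρ hε hh ha
      (fun x y hx hy => hbox _ _ (by rw [← abs_neg]; convert hx using 2; ring) hy)
      (fun p hp => by
        have := hbd _ hp
        exact ⟨by rw [← abs_neg]; convert this.1 using 2; ring, this.2⟩)
      (fun x y hxy => by
        obtain ⟨d, hd, hd0, hdC⟩ := hstep _ _ hxy
        refine ⟨(-d.1, d.2), ?_, ?_, ?_⟩
        · simp only [differenceCell, Finset.mem_product, Finset.mem_Ioo] at hd ⊢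
          omega
        · intro h0
          apply hd0
          simpa [Prod.ext_iff] using h0
        · simp only [hC'def, Set.mem_ofPred_eq]
          convert hdC using 2
          push_cast
          ring)
      h₁ h₂ ha₁.le ha₂.le ha₃.le (abs_le.2 ⟨by push_cast; linarith, by push_cast; linarith⟩)
      (by omega) ((hneg k y).2 hy)
    refine ⟨-k', y', y'', by omega, by omega, by omega, ?_, (hneg _ _).1 h7, h8⟩
    rw [← hneg, neg_neg]
    exact h6

/-! ### Euler characteristic and multigrid convergence -/

/-- The parallel set at distance `r` lies between balls of radii `r` and `R + r`. -/
theorem eulerChar_eq_one {K : Set Plane} (hK : K ∈ convexBodies) : eulerChar K = 1 := by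
  obtain ⟨hcomp, -, x, hx⟩ := hK
  have hxK := interior_subset hx
  obtain ⟨R, hR0, hR⟩ := hcomp.isBounded.subset_closedBall_lt 0 (0 : Plane)
  have hvol : ∀ (y : Plane) (r : ℝ), 0 ≤ r →
      (volume (Metric.closedBall y r)).toReal = Real.pi * r ^ 2 := by
    intro y r hr
    rw [EuclideanSpace.volume_closedBall_fin_two, ENNReal.toReal_mul, ENNReal.toReal_pow,
      ENNReal.toReal_ofReal hr, ENNReal.toReal_ofReal Real.pi_pos.le, mul_comm]
  have hlow : ∀ r : ℝ, Metric.closedBall x r ⊆ K + Metric.closedBall (0 : Plane) r := by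
    intro r y hy
    refine ⟨x, hxK, y - x, ?_, add_sub_cancel x y⟩
    simpa [dist_eq_norm] using hy
  have hup : ∀ r : ℝ, K + Metric.closedBall (0 : Plane) r ⊆ Metric.closedBall 0 (R + r) := by
    rintro r _ ⟨y, hy, z, hz, rfl⟩
    have h1 := hR hy
    simp only [Metric.mem_closedBall, dist_zero_right] at h1 hz ⊢
    exact (norm_add_le y z).trans (add_le_add h1 hz)
  have hfin : ∀ (y : Plane) (r : ℝ), volume (Metric.closedBall y r) ≠ ⊤ := fun y r =>
    measure_closedBall_lt_top.ne
  refine Tendsto.limUnder_eq ?_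
  have hlim : Tendsto (fun r : ℝ => (R / r + 1) ^ 2) atTop (𝓝 1) := by
    have : Tendsto (fun r : ℝ => (R / r + 1) ^ 2) atTop (𝓝 ((0 + 1) ^ 2)) :=
      ((tendsto_const_nhds.div_atTop tendsto_id).add_const 1).pow 2
    simpa using this
  refine tendsto_of_tendsto_of_tendsto_of_le_of_le' tendsto_const_nhds hlim ?_ ?_
  · filter_upwards [eventually_gt_atTop 0] with r hr
    rw [le_div_iff₀ (by positivity), one_mul, ← hvol x r hr.le]
    exact ENNReal.toReal_mono (measure_ne_top_of_subset (hup r) (hfin _ _)) (measure_mono (hlow r))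
  · filter_upwards [eventually_gt_atTop 0] with r hr
    rw [div_le_iff₀ (by positivity)]
    calc _ ≤ (volume (Metric.closedBall (0 : Plane) (R + r))).toReal :=
          ENNReal.toReal_mono (hfin _ _) (measure_mono (hup r))
      _ = Real.pi * (R + r) ^ 2 := hvol _ _ (by linarith)
      _ = _ := by
        field_simp

theorem multigridConvergent_of_not_isCritical (ξ : Module.Basis (Fin 2) ℝ Plane) {n : ℕ}
    (hn : 0 < n) {𝒮 : Set (Set Plane)}
    (h : ∀ K ∈ 𝒮, K ∈ convexBodies ∧ ∀ x, ¬ IsCritical n ξ K x) :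
    MultigridConvergent (localEuler n ξ) eulerChar 𝒮 := by
  intro K hK
  obtain ⟨hb, hcrit⟩ := h K hK
  obtain ⟨δ, hδ, hone⟩ := localEuler_eq_one ξ hn hb hcrit
  rw [eulerChar_eq_one hb]
  refine tendsto_const_nhds.congr' ?_
  filter_upwards [Ioo_mem_nhdsGT hδ] with a ha
  exact (hone a ha.1 ha.2 0).symm

/-! ### The cone at a critical point -/

theorem IsCritical.eq_zero {n : ℕ} {ξ : Module.Basis (Fin 2) ℝ Plane} {K : Set Plane} {x : Plane}
    (h : IsCritical n ξ K x) {a : ℝ} (ha : 0 < a) {d : ℤ × ℤ} (hd : d ∈ differenceCell n)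
    (hK : x + a • latticePoint ξ d ∈ K) : a • latticePoint ξ d = 0 := by
  have : a • latticePoint ξ d ∈ ({0} : Set Plane) := by
    rw [← h.2 a ha]
    exact ⟨⟨_, hK, add_sub_cancel_left _ _⟩, d, hd, rfl⟩
  exact this

theorem span_eq_top_of_interior {K : Set Plane} {x u : Plane} (hK : (interior K).Nonempty)
    (h : ∀ y ∈ K, y - x ∈ Submodule.span ℝ {u}) : False := by
  obtain ⟨w, hw⟩ := hK
  have htop : Submodule.span ℝ {u} = (⊤ : Submodule ℝ Plane) := by
    refine eq_top_iff.2 fun e _ => ?_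
    have hc : Continuous fun t : ℝ => w + t • e := by fun_prop
    have h0 : ∀ᶠ t in 𝓝 (0 : ℝ), w + t • e ∈ interior K :=
      hc.continuousAt.preimage_mem_nhds (isOpen_interior.mem_nhds (by simpa using hw))
    have h1 : ∀ᶠ t in 𝓝[>] (0 : ℝ), w + t • e ∈ interior K :=
      h0.filter_mono nhdsWithin_le_nhds
    obtain ⟨t, ht, ht0⟩ := (h1.and self_mem_nhdsWithin).exists
    have h2 := Submodule.sub_mem _ (h _ (interior_subset ht)) (h _ (interior_subset hw))
    rw [show w + t • e - x - (w - x) = t • e by abel] at h2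
    exact (Submodule.smul_mem_iff _ (ne_of_gt ht0)).1 h2
  have h1 := finrank_span_le_card (R := ℝ) ({u} : Set Plane)
  rw [htop, finrank_top, finrank_euclideanSpace] at h1
  simp at h1

/-- At a critical point `x` of `K`, a linear functional whose kernel is spanned by a difference of
lattice points has constant strict sign on `K - x`. -/
theorem IsCritical.exists_sign {n : ℕ} {ξ : Module.Basis (Fin 2) ℝ Plane} {K : Set Plane}
    {x : Plane} (h : IsCritical n ξ K x) (hconv : Convex ℝ K) (hint : (interior K).Nonempty)
    (L : Plane →ₗ[ℝ] ℝ)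
    (hL : ∀ v, L v = 0 → v ≠ 0 → ∃ d ∈ differenceCell n, ∃ s : ℝ, 0 < s ∧ v = s • latticePoint ξ d) :
    ∃ s : ℝ, (s = 1 ∨ s = -1) ∧ ∀ y ∈ K, y ≠ x → 0 < s * L (y - x) := by
  have hne : ∀ y ∈ K, L (y - x) = 0 → y = x := by
    intro y hy h0
    by_contra hyx
    obtain ⟨d, hd, s, hs, hv⟩ := hL _ h0 (sub_ne_zero.2 hyx)
    have := h.eq_zero hs hd (by rw [← hv]; simpa using hy)
    rw [← hv] at this
    exact hyx (sub_eq_zero.1 this)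
  by_contra hcon
  push Not at hcon
  obtain ⟨y, hy, hyx, hLy⟩ := hcon 1 (Or.inl rfl)
  obtain ⟨z, hz, hzx, hLz⟩ := hcon (-1) (Or.inr rfl)
  have hLy : L (y - x) < 0 := lt_of_le_of_ne (by linarith) fun h => hyx (hne y hy h)
  have hLz : 0 < L (z - x) := lt_of_le_of_ne (by linarith) fun h => hzx (hne z hz h.symm)
  -- A segment joining opposite sides of the kernel line can cross it only at `x`, so `p - x` and `q
  -- - x` are dependent. If both sides occurred, `K` would lie on one line.
  have hdep : ∀ p ∈ K, ∀ q ∈ K, L (p - x) < 0 → 0 < L (q - x) →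
      L (q - x) • (p - x) = L (p - x) • (q - x) := by
    intro p hp q hq h1 h2
    have hpos : 0 < L (q - x) - L (p - x) := by linarith
    set r := L (q - x) / (L (q - x) - L (p - x)) with hr
    have hr0 : 0 ≤ r := by positivity
    have hr1 : r ≤ 1 := (div_le_one hpos).2 (by linarith)
    have hmem := hconv hp hq hr0 (sub_nonneg.2 hr1) (by ring)
    have hsub : r • p + (1 - r) • q - x = r • (p - x) + (1 - r) • (q - x) := by module
    have hz : r • (p - x) + (1 - r) • (q - x) = 0 := by
      rw [← hsub, sub_eq_zero]
      refine hne _ hmem ?_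
      rw [hsub, map_add, map_smul, map_smul, smul_eq_mul, smul_eq_mul, hr]
      field_simp
      ring
    have h3 : (L (q - x) - L (p - x)) • (r • (p - x) + (1 - r) • (q - x))
        = L (q - x) • (p - x) - L (p - x) • (q - x) := by
      have h4 : (L (q - x) - L (p - x)) * r = L (q - x) := mul_div_cancel₀ _ hpos.ne'
      have h5 : (L (q - x) - L (p - x)) * (1 - r) = - L (p - x) := by
        rw [mul_sub, h4]
        ring
      rw [smul_add, smul_smul, smul_smul, h4, h5]
      module
    rw [hz, smul_zero] at h3
    exact (sub_eq_zero.1 h3.symm)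
  have hspan : ∀ p ∈ K, p - x ∈ Submodule.span ℝ {z - x} := by
    have hneg : ∀ p ∈ K, L (p - x) < 0 → p - x ∈ Submodule.span ℝ {z - x} := by
      intro p hp h1
      rw [← Submodule.smul_mem_iff _ hLz.ne', hdep p hp z hz h1 hLz]
      exact Submodule.smul_mem _ _ (Submodule.mem_span_singleton_self _)
    intro p hp
    rcases lt_trichotomy (L (p - x)) 0 with h1 | h1 | h1
    · exact hneg p hp h1
    · rw [hne p hp h1, sub_self]
      exact Submodule.zero_mem _
    · rw [← Submodule.smul_mem_iff _ hLy.ne, ← hdep y hy p hp hLy h1]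
      exact Submodule.smul_mem _ _ (hneg y hy hLy)
  exact span_eq_top_of_interior hint hspan

theorem exists_latticePoint_of_coord_zero {n : ℕ} (hn : 2 ≤ n) (ξ : Module.Basis (Fin 2) ℝ Plane)
    (e : ℤ × ℤ) (he : e ∈ differenceCell 2) {v : Plane} (hv : v ≠ 0) {r : ℝ}
    (hr : v = r • latticePoint ξ e) :
    ∃ d ∈ differenceCell n, ∃ s : ℝ, 0 < s ∧ v = s • latticePoint ξ d := by
  simp only [differenceCell, Finset.mem_product, Finset.mem_Ioo] at he ⊢
  have hr0 : r ≠ 0 := by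
    rintro rfl
    exact hv (by simp [hr])
  rcases lt_or_gt_of_ne hr0 with h | h
  · refine ⟨-e, ?_, -r, by linarith, ?_⟩
    · simp only [Prod.fst_neg, Prod.snd_neg]
      omega
    · rw [hr, latticePoint, latticePoint]
      simp only [Prod.fst_neg, Prod.snd_neg]
      push_cast
      module
  · exact ⟨e, by omega, r, h, hr⟩

theorem IsCritical.exists_sign_coord {n : ℕ} (hn : 2 ≤ n) {ξ : Module.Basis (Fin 2) ℝ Plane}
    {K : Set Plane} {x : Plane} (h : IsCritical n ξ K x) (hconv : Convex ℝ K)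
    (hint : (interior K).Nonempty) :
    ∃ s : Fin 2 → ℝ, (∀ i, s i = 1 ∨ s i = -1) ∧
      ∀ y ∈ K, y ≠ x → ∀ i, 0 < s i * ξ.repr (y - x) i := by
  have key : ∀ i, ∃ s : ℝ, (s = 1 ∨ s = -1) ∧ ∀ y ∈ K, y ≠ x → 0 < s * ξ.coord i (y - x) := by
    intro i
    refine h.exists_sign hconv hint (ξ.coord i) fun v hv hv0 => ?_
    have hsum := sum_repr_eq ξ v
    fin_cases i
    · refine exists_latticePoint_of_coord_zero hn ξ (0, 1) (by decide) hv0 (r := ξ.repr v 1) ?_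
      simp only [Fin.zero_eta, Module.Basis.coord_apply] at hv
      conv_lhs => rw [← hsum, hv]
      simp [latticePoint]
    · refine exists_latticePoint_of_coord_zero hn ξ (1, 0) (by decide) hv0 (r := ξ.repr v 0) ?_
      simp only [Fin.mk_one, Module.Basis.coord_apply] at hv
      conv_lhs => rw [← hsum, hv]
      simp [latticePoint]
  choose s hs hpos using key
  exact ⟨s, hs, fun y hy hyx i => hpos i y hy hyx⟩

/-- Up to sign, a coordinate attains its minimum over `K` at `x` alone. -/
theorem IsCritical.mem_extremePoints {n : ℕ} (hn : 2 ≤ n) {ξ : Module.Basis (Fin 2) ℝ Plane}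
    {K : Set Plane} {x : Plane} (h : IsCritical n ξ K x) (hclosed : IsClosed K)
    (hconv : Convex ℝ K) (hint : (interior K).Nonempty) : x ∈ K.extremePoints ℝ := by
  obtain ⟨s, -, hs⟩ := h.exists_sign_coord hn hconv hint
  have hle : ∀ y ∈ K, 0 ≤ s 0 * ξ.repr (y - x) 0 := by
    intro y hy
    by_cases hyx : y = x
    · simp [hyx]
    · exact (hs y hy hyx 0).le
  refine ⟨hclosed.frontier_subset h.1, ?_⟩
  rintro y hy z hz ⟨a, b, ha, hb, hab, hx⟩
  by_contra hyx
  have h1 := hs y hy hyx 0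
  have h2 := hle z hz
  have h3 : a • (y - x) + b • (z - x) = 0 := by
    have : a • (y - x) + b • (z - x) = a • y + b • z - (a + b) • x := by module
    rw [this, hab, hx, one_smul, sub_self]
  have h4 := congrArg (fun v => s 0 * ξ.repr v 0) h3
  simp only [map_add, map_smul, Finsupp.add_apply, Finsupp.smul_apply, smul_eq_mul, map_zero,
    Finsupp.zero_apply, mul_zero] at h4
  nlinarith [mul_pos ha h1, mul_nonneg hb.le h2]

/-! ### Cones free of difference vectors -/

/-- The vectors `u`, `v` lie in the same open quadrant with respect to the basis `ξ`. -/
def SameQuadrant (ξ : Module.Basis (Fin 2) ℝ Plane) (u v : Plane) : Prop :=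
  ∃ s : Fin 2 → ℝ, (∀ i, s i = 1 ∨ s i = -1) ∧
    ∀ i, 0 < s i * ξ.repr u i ∧ 0 < s i * ξ.repr v i

/-- The open cone spanned by `u`, `v` lies in an open quadrant and contains no point of the
difference cell. -/
def FreePair (n : ℕ) (ξ : Module.Basis (Fin 2) ℝ Plane) (u v : Plane) : Prop :=
  SameQuadrant ξ u v ∧ ∀ d ∈ differenceCell n, ∀ α β : ℝ, 0 < α → 0 < β →
    α • u + β • v ≠ latticePoint ξ d

theorem SameQuadrant.smul {ξ : Module.Basis (Fin 2) ℝ Plane} {u v : Plane}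
    (h : SameQuadrant ξ u v) {α β : ℝ} (hα : 0 < α) (hβ : 0 < β) :
    SameQuadrant ξ (α • u) (β • v) := by
  obtain ⟨s, hs, h⟩ := h
  refine ⟨s, hs, fun i => ?_⟩
  simp only [map_smul, Finsupp.smul_apply, smul_eq_mul]
  exact ⟨by nlinarith [mul_pos hα (h i).1], by nlinarith [mul_pos hβ (h i).2]⟩

theorem FreePair.smul {n : ℕ} {ξ : Module.Basis (Fin 2) ℝ Plane} {u v : Plane}
    (h : FreePair n ξ u v) {α β : ℝ} (hα : 0 < α) (hβ : 0 < β) :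
    FreePair n ξ (α • u) (β • v) := by
  refine ⟨h.1.smul hα hβ, fun d hd α' β' hα' hβ' => ?_⟩
  rw [smul_smul, smul_smul]
  exact h.2 d hd _ _ (by positivity) (by positivity)

theorem SameQuadrant.ne_zero {ξ : Module.Basis (Fin 2) ℝ Plane} {u v : Plane}
    (h : SameQuadrant ξ u v) : u ≠ 0 ∧ v ≠ 0 := by
  obtain ⟨s, -, h⟩ := h
  constructor
  · rintro rfl
    simpa using (h 0).1
  · rintro rfl
    simpa using (h 0).2

/-- A difference vector in the open cone, divided by `α + β`, would be a nonzero vector of `K - x`.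
-/
theorem IsCritical.freePair {n : ℕ} (hn : 2 ≤ n) {ξ : Module.Basis (Fin 2) ℝ Plane}
    {K : Set Plane} {x : Plane} (h : IsCritical n ξ K x) (hconv : Convex ℝ K)
    (hint : (interior K).Nonempty) {y z : Plane} (hy : y ∈ K) (hz : z ∈ K) (hyx : y ≠ x)
    (hzx : z ≠ x) : FreePair n ξ (y - x) (z - x) := by
  obtain ⟨s, hs, hpos⟩ := h.exists_sign_coord hn hconv hint
  refine ⟨⟨s, hs, fun i => ⟨hpos y hy hyx i, hpos z hz hzx i⟩⟩, fun d hd α β hα hβ hd' => ?_⟩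
  have hab : 0 < α + β := by linarith
  have hmem := hconv hy hz (div_nonneg hα.le hab.le) (div_nonneg hβ.le hab.le) (by field_simp)
  have heq : (α / (α + β)) • y + (β / (α + β)) • z = x + (α + β)⁻¹ • latticePoint ξ d := by
    rw [← hd']
    have h1 : x + (α + β)⁻¹ • (α • (y - x) + β • (z - x)) = (1 - (α + β)⁻¹ * (α + β)) • x
        + (α * (α + β)⁻¹) • y + (β * (α + β)⁻¹) • z := by module
    rw [h1, inv_mul_cancel₀ hab.ne', sub_self, zero_smul, zero_add, div_eq_mul_inv, div_eq_mul_inv]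
  rw [heq] at hmem
  have h0 := h.eq_zero (inv_pos.2 hab) hd hmem
  rw [← hd', smul_eq_zero_iff_right (inv_pos.2 hab).ne'] at h0
  have h4 := congrArg (fun v => s 0 * ξ.repr v 0) h0
  simp only [map_add, map_smul, Finsupp.add_apply, Finsupp.smul_apply, smul_eq_mul, map_zero,
    Finsupp.zero_apply, mul_zero] at h4
  nlinarith [mul_pos hα (hpos y hy hyx 0), mul_pos hβ (hpos z hz hzx 0)]

theorem exists_coord_bound (ξ : Module.Basis (Fin 2) ℝ Plane) :
    ∃ M : ℝ, 0 < M ∧ ∀ v i, |ξ.repr v i| ≤ M * ‖v‖ := by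
  have h : ∀ i, ∃ M : ℝ, 0 < M ∧ ∀ v, |ξ.repr v i| ≤ M * ‖v‖ := by
    intro i
    obtain ⟨M, hM, h⟩ := (LinearMap.toContinuousLinearMap (ξ.coord i)).bound
    exact ⟨M, hM, h⟩
  obtain ⟨M₀, hM₀, h0⟩ := h 0
  obtain ⟨M₁, hM₁, h1⟩ := h 1
  refine ⟨max M₀ M₁, lt_max_of_lt_left hM₀, fun v i => ?_⟩
  have := norm_nonneg v
  fin_cases i
  · exact (h0 v).trans (by gcongr; exact le_max_left _ _)
  · exact (h1 v).trans (by gcongr; exact le_max_right _ _)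

theorem norm_le_abs_coord (ξ : Module.Basis (Fin 2) ℝ Plane) (v : Plane) :
    ‖v‖ ≤ (|ξ.repr v 0| + |ξ.repr v 1|) * (‖ξ 0‖ + ‖ξ 1‖) := by
  conv_lhs => rw [← sum_repr_eq ξ v]
  refine (norm_add_le _ _).trans ?_
  rw [norm_smul, norm_smul, Real.norm_eq_abs, Real.norm_eq_abs]
  nlinarith [mul_nonneg (abs_nonneg (ξ.repr v 0)) (norm_nonneg (ξ 1)),
    mul_nonneg (abs_nonneg (ξ.repr v 1)) (norm_nonneg (ξ 0))]

theorem norm_basis_pos (ξ : Module.Basis (Fin 2) ℝ Plane) : 0 < ‖ξ 0‖ + ‖ξ 1‖ :=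
  add_pos_of_pos_of_nonneg (norm_pos_iff.2 (ξ.ne_zero 0)) (norm_nonneg _)

theorem SameQuadrant.exists_unit {ξ : Module.Basis (Fin 2) ℝ Plane} {u v : Plane}
    (h : SameQuadrant ξ u v) : ∃ α β : ℝ, 0 < α ∧ 0 < β ∧ ‖α • u‖ = 1 ∧ ‖β • v‖ = 1 := by
  obtain ⟨hu, hv⟩ := h.ne_zero
  refine ⟨‖u‖⁻¹, ‖v‖⁻¹, by positivity, by positivity, ?_, ?_⟩ <;>
  · rw [norm_smul, norm_inv, norm_norm]
    exact inv_mul_cancel₀ (by positivity)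

/-- Coordinates of equal sign do not cancel, so unit vectors in one quadrant satisfy `‖u + v‖ ≥ κ`,
which bounds their inner product below by `κ ^ 2 / 2 - 1`. -/
theorem exists_angle_bound (ξ : Module.Basis (Fin 2) ℝ Plane) :
    ∃ ψ : ℝ, 0 ≤ ψ ∧ ψ < Real.pi ∧
      ∀ u v, SameQuadrant ξ u v → InnerProductGeometry.angle u v ≤ ψ := by
  obtain ⟨M, hM, hcoord⟩ := exists_coord_bound ξ
  set B := ‖ξ 0‖ + ‖ξ 1‖ with hB
  have hBpos : 0 < B := norm_basis_pos ξ
  set κ := 1 / (B * M) with hκ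
  have hκpos : 0 < κ := by positivity
  refine ⟨Real.arccos (κ ^ 2 / 2 - 1), Real.arccos_nonneg _, ?_, fun u v huv => ?_⟩
  · refine lt_of_le_of_ne (Real.arccos_le_pi _) fun h => ?_
    rw [Real.arccos_eq_pi] at h
    nlinarith [sq_pos_of_pos hκpos]
  · obtain ⟨α, β, hα, hβ, hu1, hv1⟩ := huv.exists_unit
    rw [← InnerProductGeometry.angle_smul_left_of_pos u v hα,
      ← InnerProductGeometry.angle_smul_right_of_pos _ v hβ]
    obtain ⟨s, hs, h⟩ := huv.smul hα hβ
    generalize α • u = u at *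
    generalize β • v = v at *
    have habs : ∀ i (t : ℝ), 0 < s i * t → |t| = s i * t := by
      intro i t ht
      rcases hs i with h1 | h1 <;> rw [h1] at ht ⊢
      · rw [one_mul] at ht ⊢
        exact abs_of_pos ht
      · rw [neg_one_mul] at ht ⊢
        exact abs_of_neg (by linarith)
    have e1 := norm_le_abs_coord ξ u
    have e2 := norm_le_abs_coord ξ v
    rw [habs 0 _ (h 0).1, habs 1 _ (h 1).1, hu1] at e1
    rw [habs 0 _ (h 0).2, habs 1 _ (h 1).2, hv1] at e2
    have e3 : ∀ i, s i * ξ.repr u i + s i * ξ.repr v i ≤ M * ‖u + v‖ := by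
      intro i
      refine le_trans ?_ (hcoord (u + v) i)
      rw [map_add, Finsupp.add_apply, habs i (ξ.repr u i + ξ.repr v i)
        (by rw [mul_add]; exact add_pos (h i).1 (h i).2), mul_add]
    have hsum : κ ≤ ‖u + v‖ := by
      rw [hκ, div_le_iff₀ (by positivity)]
      nlinarith [e3 0, e3 1, mul_le_mul_of_nonneg_left (add_le_add (e3 0) (e3 1)) hBpos.le]
    have hsq : ‖u + v‖ ^ 2 = 2 + 2 * inner ℝ u v := by
      rw [norm_add_sq_real, hu1, hv1]
      ring
    rw [InnerProductGeometry.angle, hu1, hv1]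
    refine Real.arccos_le_arccos ?_
    nlinarith

/-- Completing the square bounds both `α ^ 2 * (1 - c ^ 2)` and `β ^ 2 * (1 - c ^ 2)` by `‖e‖ ^ 2`:
the rhombus on `u`, `v` has height at least `√(1 - c ^ 2)`. -/
theorem exists_combination_of_unit {u v e : Plane} (hu : ‖u‖ = 1) (hv : ‖v‖ = 1) {c : ℝ}
    (hc : |inner ℝ u v| ≤ c) (he : ‖e‖ ^ 2 < 1 - c ^ 2) :
    ∃ α β : ℝ, |α| < 1 ∧ |β| < 1 ∧ e = α • u + β • v := by
  have hexp : ∀ α β : ℝ, ‖α • u + β • v‖ ^ 2 = α ^ 2 + β ^ 2 + 2 * α * β * inner ℝ u v := by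
    intro α β
    rw [norm_add_sq_real, norm_smul, norm_smul, hu, hv, inner_smul_left, inner_smul_right]
    simp
    ring
  have hc2 : (inner ℝ u v) ^ 2 ≤ c ^ 2 := by
    rw [← sq_abs]
    exact pow_le_pow_left₀ (abs_nonneg _) hc 2
  have hpos : 0 < 1 - c ^ 2 := (sq_nonneg _).trans_lt he
  have hα : ∀ α β : ℝ, α ^ 2 * (1 - c ^ 2) ≤ ‖α • u + β • v‖ ^ 2 := by
    intro α β
    rw [hexp]
    nlinarith [sq_nonneg (β + α * inner ℝ u v), mul_nonneg (sq_nonneg α) (sub_nonneg.2 hc2)]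
  have hβ : ∀ α β : ℝ, β ^ 2 * (1 - c ^ 2) ≤ ‖α • u + β • v‖ ^ 2 := by
    intro α β
    rw [hexp]
    nlinarith [sq_nonneg (α + β * inner ℝ u v), mul_nonneg (sq_nonneg β) (sub_nonneg.2 hc2)]
  have hli : LinearIndependent ℝ ![u, v] := by
    rw [LinearIndependent.pair_iff]
    intro s t hst
    have h1 := hα s t
    have h2 := hβ s t
    rw [hst, norm_zero] at h1 h2
    constructor <;> by_contra h
    · nlinarith [mul_pos (sq_pos_of_ne_zero h) hpos]
    · nlinarith [mul_pos (sq_pos_of_ne_zero h) hpos]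
  have hspan := hli.span_eq_top_of_card_eq_finrank (by simp)
  have hmem : e ∈ Submodule.span ℝ {u, v} := by
    have : Set.range ![u, v] = {u, v} := by
      simp only [Matrix.range_cons, Matrix.range_empty, Set.union_empty, Set.singleton_union]
    rw [← this, hspan]
    trivial
  obtain ⟨α, β, rfl⟩ := Submodule.mem_span_pair.1 hmem
  refine ⟨α, β, ?_, ?_, rfl⟩
  · rw [← sq_lt_one_iff_abs_lt_one]
    by_contra hcon
    nlinarith [hα α β]
  · rw [← sq_lt_one_iff_abs_lt_one]
    by_contra hcon
    nlinarith [hβ α β]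

/-- Rounding: every vector is approximated by a scaled point of a large difference cell. -/
theorem exists_approx_latticePoint (ξ : Module.Basis (Fin 2) ℝ Plane) {R η : ℝ} (hR : 0 < R)
    (hη : 0 < η) : ∃ N : ℕ, ∀ n, N ≤ n → ∃ M : ℝ, 0 < M ∧ ∀ b : Plane,
      (∀ i, |ξ.repr b i| ≤ R) → ∃ d ∈ differenceCell n, ‖M⁻¹ • latticePoint ξ d - b‖ < η := by
  have hB := norm_basis_pos ξ
  set B := ‖ξ 0‖ + ‖ξ 1‖
  obtain ⟨N, hN⟩ := exists_nat_gt (R * B / η + 3)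
  refine ⟨N, fun n hn => ?_⟩
  have hnN : (N : ℝ) ≤ n := by exact_mod_cast hn
  have hRB : 0 < R * B / η := by positivity
  have hn2 : 0 < (n : ℝ) - 2 := by linarith
  -- This scale keeps the coordinates within `n - 2` in absolute value, so they stay inside the cell
  -- after rounding.
  refine ⟨(n - 2) / R, by positivity, fun b hb => ?_⟩
  set M := ((n : ℝ) - 2) / R with hM
  have hMpos : 0 < M := by positivity
  have hMR : M * R = n - 2 := div_mul_cancel₀ _ hR.ne'
  have hround : ∀ i, |(round (M * ξ.repr b i) : ℝ) - M * ξ.repr b i| ≤ 1 / 2 := fun i => by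
    rw [abs_sub_comm]
    exact abs_sub_round _
  have hint : ∀ i, -(n : ℤ) < round (M * ξ.repr b i) ∧ round (M * ξ.repr b i) < (n : ℤ) := by
    intro i
    have h1 := abs_le.1 (hround i)
    have h2 : |M * ξ.repr b i| ≤ n - 2 := by
      rw [abs_mul, abs_of_pos hMpos, ← hMR]
      exact mul_le_mul_of_nonneg_left (hb i) hMpos.le
    rw [abs_le] at h2
    constructor
    · have : (-(n : ℝ)) < round (M * ξ.repr b i) := by linarith
      exact_mod_cast this
    · have : (round (M * ξ.repr b i) : ℝ) < n := by linarith
      exact_mod_cast this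
  refine ⟨(round (M * ξ.repr b 0), round (M * ξ.repr b 1)), ?_, ?_⟩
  · simp only [differenceCell, Finset.mem_product, Finset.mem_Ioo]
    exact ⟨hint 0, hint 1⟩
  · set e := M⁻¹ • latticePoint ξ (round (M * ξ.repr b 0), round (M * ξ.repr b 1)) - b with he
    have hcoord : ∀ i, |ξ.repr e i| ≤ M⁻¹ * (1 / 2) := by
      intro i
      have : ξ.repr e i = M⁻¹ * (round (M * ξ.repr b i) - M * ξ.repr b i) := by
        rw [mul_sub, inv_mul_cancel_left₀ hMpos.ne', he]
        fin_cases i <;> simp [latticePoint]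
      rw [this, abs_mul, abs_of_pos (inv_pos.2 hMpos)]
      exact mul_le_mul_of_nonneg_left (hround i) (inv_pos.2 hMpos).le
    have hnorm := norm_le_abs_coord ξ e
    have h1 : ‖e‖ ≤ M⁻¹ * B := by
      refine hnorm.trans ?_
      have := add_le_add (hcoord 0) (hcoord 1)
      nlinarith
    refine h1.trans_lt ?_
    rw [inv_mul_lt_iff₀ hMpos, hM, div_mul_eq_mul_div, lt_div_iff₀ hR]
    have h2 : R * B / η < n - 2 := by linarith
    rw [div_lt_iff₀ hη] at h2
    linarith

/-- For unit vectors at an angle in `[η, ψ]`, the open cone contains a ball of fixed radius about `u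
+ v`, and hence a scaled difference vector when `n` is large. -/
theorem exists_angle_lt (ξ : Module.Basis (Fin 2) ℝ Plane) {η : ℝ} (hη : 0 < η) :
    ∃ N : ℕ, ∀ n, N ≤ n → ∀ u v, FreePair n ξ u v → InnerProductGeometry.angle u v < η := by
  obtain ⟨ψ, hψ0, hψ, hbound⟩ := exists_angle_bound ξ
  obtain ⟨M₀, hM₀, hcoord⟩ := exists_coord_bound ξ
  by_cases hηψ : ψ < η
  · exact ⟨0, fun n _ u v h => (hbound u v h.1).trans_lt hηψ⟩
  push Not at hηψ
  have hcos : ∀ θ : ℝ, 0 < θ → θ < Real.pi → |Real.cos θ| < 1 := by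
    intro θ h1 h2
    rw [← sq_lt_one_iff_abs_lt_one]
    have := Real.sin_pos_of_pos_of_lt_pi h1 h2
    nlinarith [Real.sin_sq_add_cos_sq θ]
  set c := max |Real.cos η| |Real.cos ψ| with hc
  have hc1 : c < 1 := max_lt (hcos η hη (hηψ.trans_lt hψ)) (hcos ψ (hη.trans_le hηψ) hψ)
  have hc0 : 0 ≤ c := (abs_nonneg _).trans (le_max_left _ _)
  have hc2 : 0 < 1 - c ^ 2 := by nlinarith
  obtain ⟨N, hN⟩ := exists_approx_latticePoint ξ (R := M₀ * 2) (η := Real.sqrt (1 - c ^ 2))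
    (by positivity) (Real.sqrt_pos.2 hc2)
  refine ⟨N, fun n hn u v huv => ?_⟩
  by_contra hcon
  push Not at hcon
  have hle := hbound u v huv.1
  obtain ⟨α₀, β₀, hα₀, hβ₀, hu1, hv1⟩ := huv.1.exists_unit
  rw [← InnerProductGeometry.angle_smul_left_of_pos u v hα₀,
    ← InnerProductGeometry.angle_smul_right_of_pos _ v hβ₀] at hcon hle
  have huv := huv.smul hα₀ hβ₀
  generalize α₀ • u = u at *
  generalize β₀ • v = v at *
  have hcosuv : Real.cos (InnerProductGeometry.angle u v) = inner ℝ u v := by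
    rw [InnerProductGeometry.cos_angle, hu1, hv1]
    simp
  have hin : |inner ℝ u v| ≤ c := by
    rw [← hcosuv, abs_le]
    constructor
    · refine le_trans ?_ (Real.cos_le_cos_of_nonneg_of_le_pi
        (InnerProductGeometry.angle_nonneg u v) hψ.le hle)
      exact neg_le.1 ((neg_le_abs _).trans (le_max_right _ _))
    · refine (Real.cos_le_cos_of_nonneg_of_le_pi hη.le
        (InnerProductGeometry.angle_le_pi u v) hcon).trans ?_
      exact (le_abs_self _).trans (le_max_left _ _)
  obtain ⟨M, hM, happ⟩ := hN n hn
  obtain ⟨d, hd, he⟩ := happ (u + v) fun i => (hcoord _ i).trans (by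
    have := norm_add_le u v
    rw [hu1, hv1] at this
    exact mul_le_mul_of_nonneg_left (this.trans (by norm_num)) hM₀.le)
  have he2 : ‖M⁻¹ • latticePoint ξ d - (u + v)‖ ^ 2 < 1 - c ^ 2 :=
    (Real.lt_sqrt (norm_nonneg _)).1 he
  obtain ⟨α, β, hα, hβ, heq⟩ := exists_combination_of_unit hu1 hv1 hin he2
  rw [abs_lt] at hα hβ
  refine huv.2 d hd (M * (1 + α)) (M * (1 + β)) (mul_pos hM (by linarith))
    (mul_pos hM (by linarith)) ?_
  have h1 : M⁻¹ • latticePoint ξ d = (1 + α) • u + (1 + β) • v := by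
    rw [sub_eq_iff_eq_add] at heq
    rw [heq]
    module
  rw [mul_smul, mul_smul, ← smul_add, ← h1, smul_smul, mul_inv_cancel₀ hM.ne', one_smul]

/-! ### Angle thresholds and part (ii) -/

/-- The largest opening angle of a cone that avoids the difference cell. -/
def freeAngle (ξ : Module.Basis (Fin 2) ℝ Plane) (n : ℕ) : ℝ :=
  sSup {θ | ∃ u v, FreePair n ξ u v ∧ θ = InnerProductGeometry.angle u v}

theorem freeAngle_nonneg (ξ : Module.Basis (Fin 2) ℝ Plane) (n : ℕ) : 0 ≤ freeAngle ξ n :=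
  Real.sSup_nonneg (by
    rintro _ ⟨u, v, -, rfl⟩
    exact InnerProductGeometry.angle_nonneg u v)

theorem freeAngle_lt_pi (ξ : Module.Basis (Fin 2) ℝ Plane) (n : ℕ) :
    freeAngle ξ n < Real.pi := by
  obtain ⟨ψ, hψ0, hψ, hbound⟩ := exists_angle_bound ξ
  refine (Real.sSup_le ?_ hψ0).trans_lt hψ
  rintro _ ⟨u, v, h, rfl⟩
  exact hbound u v h.1

theorem tendsto_freeAngle (ξ : Module.Basis (Fin 2) ℝ Plane) :
    Tendsto (freeAngle ξ) atTop (𝓝 0) := by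
  rw [Metric.tendsto_atTop]
  intro η hη
  obtain ⟨N, hN⟩ := exists_angle_lt ξ (half_pos hη)
  refine ⟨N, fun n hn => ?_⟩
  rw [Real.dist_eq, sub_zero, abs_of_nonneg (freeAngle_nonneg ξ n)]
  refine (Real.sSup_le ?_ (half_pos hη).le).trans_lt (half_lt_self hη)
  rintro _ ⟨u, v, h, rfl⟩
  exact (hN n hn u v h).le

theorem not_isCritical_of_anglesAtLeast {ξ : Module.Basis (Fin 2) ℝ Plane} {n : ℕ} (hn : 2 ≤ n)
    {K : Set Plane} (hK : K ∈ convexBodies) {ψ : ℝ} (hψ : freeAngle ξ n < ψ)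
    (hang : AnglesAtLeast ψ K) (x : Plane) : ¬ IsCritical n ξ K x := by
  intro h
  obtain ⟨hcomp, hconv, hint⟩ := hK
  have h1 := hang x (h.mem_extremePoints hn hcomp.isClosed hconv hint)
  refine absurd (h1.trans (Real.sSup_le ?_ (freeAngle_nonneg ξ n))) (not_le.2 hψ)
  rintro _ ⟨y, hy, z, hz, hyx, hzx, rfl⟩
  refine le_csSup ⟨Real.pi, ?_⟩ ⟨y - x, z - x, h.freePair hn hconv hint hy hz hyx hzx, rfl⟩
  rintro _ ⟨u, v, -, rfl⟩
  exact InnerProductGeometry.angle_le_pi u v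

theorem not_anglesAtLeast_of_pi_lt {K : Set Plane} (hK : K ∈ convexBodies) {ψ : ℝ}
    (hψ : Real.pi < ψ) : ¬ AnglesAtLeast ψ K := by
  intro h
  obtain ⟨hcomp, -, hint⟩ := hK
  obtain ⟨x, hx⟩ := hcomp.extremePoints_nonempty (hint.mono interior_subset)
  refine absurd ((h x hx).trans (Real.sSup_le ?_ Real.pi_pos.le)) (not_le.2 hψ)
  rintro _ ⟨y, -, z, -, -, -, rfl⟩
  exact EuclideanGeometry.angle_le_pi y x z

theorem exists_angle_thresholds (ξ : Module.Basis (Fin 2) ℝ Plane) :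
    ∃ ψ : ℕ → ℝ, (∀ n, 0 < ψ n) ∧ (∀ n, 2 ≤ n → ψ n < Real.pi) ∧
      Tendsto ψ atTop (𝓝 0) ∧ ∀ n : ℕ, 0 < n →
        MultigridConvergent (localEuler n ξ) eulerChar
          {K | K ∈ convexBodies ∧ AnglesAtLeast (ψ n) K} := by
  -- The added term makes `φ n` exceed `freeAngle ξ n` strictly, stays below `π` for `n ≥ 2`, and
  -- vanishes in the limit.
  set φ : ℕ → ℝ := fun n => freeAngle ξ n + (Real.pi - freeAngle ξ n) / n with hφ
  have hlt := freeAngle_lt_pi ξ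
  have hnn := freeAngle_nonneg ξ
  -- No interior angle reaches `π + 1`, so for `n = 1` the class is empty.
  refine ⟨fun n => if n < 2 then Real.pi + 1 else φ n, ?_, ?_, ?_, ?_⟩
  · intro n
    dsimp only
    split_ifs with h
    · linarith [Real.pi_pos]
    · have : (0 : ℝ) < n := by exact_mod_cast (by omega : 0 < n)
      exact add_pos_of_nonneg_of_pos (hnn n) (div_pos (sub_pos.2 (hlt n)) this)
  · intro n hn
    dsimp only
    rw [if_neg (by omega)]
    have h2 : (1 : ℝ) < n := by exact_mod_cast (by omega : 1 < n)
    have := div_lt_self (sub_pos.2 (hlt n)) h2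
    simp only [hφ]
    linarith
  · have h0 : Tendsto φ atTop (𝓝 (0 + 0)) := by
      refine (tendsto_freeAngle ξ).add ?_
      refine Tendsto.div_atTop (a := Real.pi - 0) ?_ tendsto_natCast_atTop_atTop
      exact (tendsto_freeAngle ξ).const_sub _
    rw [add_zero] at h0
    refine h0.congr' ?_
    filter_upwards [eventually_ge_atTop 2] with n hn
    rw [if_neg (by omega)]
  · intro n hn
    refine multigridConvergent_of_not_isCritical ξ hn ?_
    rintro K ⟨hK, hang⟩
    refine ⟨hK, fun x => ?_⟩
    dsimp only at hang
    split_ifs at hang with h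
    · exact absurd hang (not_anglesAtLeast_of_pi_lt hK (by linarith))
    · refine not_isCritical_of_anglesAtLeast (by omega) hK ?_ hang x
      have : (0 : ℝ) < n := by exact_mod_cast hn
      exact lt_add_of_pos_right _ (div_pos (sub_pos.2 (hlt n)) this)

/-! ### Polygons over the standard lattice and part (iii) -/

theorem convexPolygons_subset {P : Set Plane} (hP : P ∈ convexPolygons) : P ∈ convexBodies := by
  obtain ⟨⟨F, rfl⟩, hint⟩ := hP
  exact ⟨F.finite_toSet.isCompact_convexHull ℝ, convex_convexHull ℝ (F : Set Plane), hint⟩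

theorem standardBasis_repr (v : Plane) (i : Fin 2) : standardBasis.repr v i = v i := by
  simp [standardBasis]

/-- The determinant of two vectors of the plane. -/
def cross (u v : Plane) : ℝ := u 0 * v 1 - u 1 * v 0

/-- The inner product of two vectors of the plane. -/
def dot (u v : Plane) : ℝ := u 0 * v 0 + u 1 * v 1

theorem inner_eq_dot (u v : Plane) : inner ℝ u v = dot u v := by
  simp [PiLp.inner_apply, Fin.sum_univ_two, dot, mul_comm]

theorem norm_sq_mul_norm_sq (u v : Plane) :
    ‖u‖ ^ 2 * ‖v‖ ^ 2 = dot u v ^ 2 + cross u v ^ 2 := by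
  rw [← real_inner_self_eq_norm_sq, ← real_inner_self_eq_norm_sq, inner_eq_dot, inner_eq_dot]
  simp only [dot, cross]
  ring

/-- Subtracting the cross term from the inner product gives `p * (p' - q') + q * (p' + q')` and also
`q' * (q - p) + p' * (p + q)`; adding it gives similar forms. In each consistent octant one of the
two forms has only positive terms. -/
theorem abs_lt_of_same_octant {s₀ s₁ t₁ t₂ p q p' q' : ℝ} (hs₀ : s₀ = 1 ∨ s₀ = -1)
    (hs₁ : s₁ = 1 ∨ s₁ = -1) (ht₁ : t₁ = 1 ∨ t₁ = -1) (ht₂ : t₂ = 1 ∨ t₂ = -1)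
    (h₀ : 0 < s₀ * p) (h₁ : 0 < s₁ * q) (h₂ : 0 < t₁ * (p + q)) (h₃ : 0 < t₂ * (p - q))
    (h₀' : 0 < s₀ * p') (h₁' : 0 < s₁ * q') (h₂' : 0 < t₁ * (p' + q'))
    (h₃' : 0 < t₂ * (p' - q')) : |p * q' - q * p'| < p * p' + q * q' := by
  rw [abs_lt]
  have m1 := mul_pos h₀ h₂'
  have m2 := mul_pos h₀ h₃'
  have m3 := mul_pos h₁ h₂'
  have m4 := mul_pos h₁ h₃'
  have m5 := mul_pos h₀' h₂
  have m6 := mul_pos h₀' h₃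
  have m7 := mul_pos h₁' h₂
  have m8 := mul_pos h₁' h₃
  rcases hs₀ with rfl | rfl <;> rcases hs₁ with rfl | rfl <;> rcases ht₁ with rfl | rfl <;>
    rcases ht₂ with rfl | rfl <;> constructor <;> linarith

/-- Two vectors in the same open octant enclose an angle of less than 45 degrees. -/
theorem IsCritical.abs_cross_lt_dot {P : Set Plane} {x : Plane}
    (h : IsCritical 2 standardBasis P x) (hconv : Convex ℝ P) (hint : (interior P).Nonempty)
    {y z : Plane} (hy : y ∈ P) (hz : z ∈ P) (hyx : y ≠ x) (hzx : z ≠ x) :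
    |cross (y - x) (z - x)| < dot (y - x) (z - x) := by
  obtain ⟨s, hs, hpos⟩ := h.exists_sign_coord le_rfl hconv hint
  have hlat : ∀ (v : Plane) (e : ℤ × ℤ) (r : ℝ), v 0 = r * e.1 → v 1 = r * e.2 →
      v = r • latticePoint standardBasis e := by
    intro v e r h0 h1
    ext i
    fin_cases i
    · simpa [latticePoint, standardBasis] using h0
    · simpa [latticePoint, standardBasis] using h1
  obtain ⟨t₁, ht₁, hpos₁⟩ := h.exists_sign hconv hint
    (standardBasis.coord 0 + standardBasis.coord 1) (fun v hv hv0 => by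
      simp only [LinearMap.add_apply, Module.Basis.coord_apply, standardBasis_repr] at hv
      refine exists_latticePoint_of_coord_zero le_rfl standardBasis (1, -1) (by decide) hv0
        (hlat v _ (v 0) (by simp) ?_)
      push_cast
      linarith)
  obtain ⟨t₂, ht₂, hpos₂⟩ := h.exists_sign hconv hint
    (standardBasis.coord 0 - standardBasis.coord 1) (fun v hv hv0 => by
      simp only [LinearMap.sub_apply, Module.Basis.coord_apply, standardBasis_repr] at hv
      refine exists_latticePoint_of_coord_zero le_rfl standardBasis (1, 1) (by decide) hv0
        (hlat v _ (v 0) (by simp) ?_)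
      push_cast
      linarith)
  have hy0 := hpos y hy hyx 0
  have hy1 := hpos y hy hyx 1
  have hz0 := hpos z hz hzx 0
  have hz1 := hpos z hz hzx 1
  have hya := hpos₁ y hy hyx
  have hza := hpos₁ z hz hzx
  have hyb := hpos₂ y hy hyx
  have hzb := hpos₂ z hz hzx
  simp only [LinearMap.add_apply, LinearMap.sub_apply, Module.Basis.coord_apply,
    standardBasis_repr] at hy0 hy1 hz0 hz1 hya hza hyb hzb
  exact abs_lt_of_same_octant (hs 0) (hs 1) ht₁ ht₂ hy0 hy1 hya hyb hz0 hz1 hza hzb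

theorem mem_of_halfPlane {F : Finset Plane} {x : Plane} {a b : ℝ}
    (h : ∀ f ∈ F, 0 ≤ a * (f - x) 0 + b * (f - x) 1) {p : Plane}
    (hp : p ∈ convexHull ℝ (F : Set Plane)) : 0 ≤ a * (p - x) 0 + b * (p - x) 1 := by
  have hconv : Convex ℝ {p : Plane | 0 ≤ a * (p - x) 0 + b * (p - x) 1} := by
    intro p hp q hq s t hs ht hst
    simp only [Set.mem_ofPred_eq, PiLp.sub_apply, PiLp.add_apply, PiLp.smul_apply,
      smul_eq_mul] at *
    have : a * (s * p 0 + t * q 0 - x 0) + b * (s * p 1 + t * q 1 - x 1)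
        = s * (a * (p 0 - x 0) + b * (p 1 - x 1)) + t * (a * (q 0 - x 0) + b * (q 1 - x 1)) := by
      linear_combination (a * x 0 + b * x 1) * hst
    rw [this]
    exact add_nonneg (mul_nonneg hs hp) (mul_nonneg ht hq)
  exact convexHull_min (fun f hf => h f hf) hconv hp

/-- If the generators of a polygon see each other from `x` under small angles, so do all points. -/
theorem abs_cross_le_of_generators {F : Finset Plane} {x : Plane} {κ : ℝ}
    (h : ∀ f ∈ F, ∀ g ∈ F, |cross (f - x) (g - x)| ≤ κ * dot (f - x) (g - x)) {p q : Plane}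
    (hp : p ∈ convexHull ℝ (F : Set Plane)) (hq : q ∈ convexHull ℝ (F : Set Plane)) :
    |cross (p - x) (q - x)| ≤ κ * dot (p - x) (q - x) := by
  -- The inequality is linear in each argument separately: first `p` ranges over the hull with `g`
  -- fixed, then `q` with `p` fixed.
  have h1 : ∀ g ∈ F, ∀ σ : ℝ, (σ = 1 ∨ σ = -1) →
      0 ≤ κ * dot (p - x) (g - x) + σ * cross (p - x) (g - x) := by
    intro g hg σ hσ
    have := mem_of_halfPlane (x := x) (a := κ * (g - x) 0 + σ * (g - x) 1)
      (b := κ * (g - x) 1 - σ * (g - x) 0) (F := F) (fun f hf => by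
        have := abs_le.1 (h f hf g hg)
        simp only [cross, dot] at this
        rcases hσ with rfl | rfl <;> linarith) hp
    simp only [cross, dot]
    linarith
  have h2 : ∀ σ : ℝ, (σ = 1 ∨ σ = -1) →
      0 ≤ κ * dot (p - x) (q - x) + σ * cross (p - x) (q - x) := by
    intro σ hσ
    have := mem_of_halfPlane (x := x) (a := κ * (p - x) 0 - σ * (p - x) 1)
      (b := κ * (p - x) 1 + σ * (p - x) 0) (F := F) (fun f hf => by
        have := h1 f hf σ hσ
        simp only [cross, dot] at this
        linarith) hq
    simp only [cross, dot]
    linarith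
  rw [abs_le]
  constructor
  · linarith [h2 1 (Or.inl rfl)]
  · linarith [h2 (-1) (Or.inr rfl)]

theorem exists_ratio_lt_one {F : Finset Plane} {x : Plane}
    (h : ∀ f ∈ F, ∀ g ∈ F, f ≠ x → g ≠ x → |cross (f - x) (g - x)| < dot (f - x) (g - x)) :
    ∃ κ : ℝ, 0 ≤ κ ∧ κ < 1 ∧
      ∀ f ∈ F, ∀ g ∈ F, |cross (f - x) (g - x)| ≤ κ * dot (f - x) (g - x) := by
  set r : Plane × Plane → ℝ := fun p => |cross (p.1 - x) (p.2 - x)| / dot (p.1 - x) (p.2 - x)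
  set G := (F ×ˢ F).filter fun p => p.1 ≠ x ∧ p.2 ≠ x
  have hmem : ∀ p ∈ G, |cross (p.1 - x) (p.2 - x)| < dot (p.1 - x) (p.2 - x) := by
    intro p hp
    obtain ⟨h1, h2, h3⟩ := Finset.mem_filter.1 hp
    rw [Finset.mem_product] at h1
    exact h _ h1.1 _ h1.2 h2 h3
  have hκ : ∃ κ : ℝ, 0 ≤ κ ∧ κ < 1 ∧ ∀ p ∈ G, r p ≤ κ := by
    rcases G.eq_empty_or_nonempty with hG | hG
    · exact ⟨0, le_rfl, one_pos, by simp [hG]⟩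
    · obtain ⟨m, hm, hmax⟩ := G.exists_max_image r hG
      have hpos := (abs_nonneg _).trans_lt (hmem m hm)
      exact ⟨r m, by positivity, (div_lt_one hpos).2 (hmem m hm), hmax⟩
  obtain ⟨κ, hκ0, hκ1, hκ⟩ := hκ
  refine ⟨κ, hκ0, hκ1, fun f hf g hg => ?_⟩
  by_cases hfg : f ≠ x ∧ g ≠ x
  · have hG : (f, g) ∈ G := Finset.mem_filter.2 ⟨Finset.mem_product.2 ⟨hf, hg⟩, hfg⟩
    exact (div_le_iff₀ ((abs_nonneg _).trans_lt (hmem _ hG))).1 (hκ _ hG)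
  · rw [not_and_or, not_not, not_not] at hfg
    rcases hfg with rfl | rfl <;> simp [cross, dot]

/-- Angles below 45 degrees could still have supremum 45 degrees. Finitely many generators give a
common ratio `κ < 1` between cross and inner product, hence a uniform bound. -/
theorem not_isCritical_of_polygon {P : Set Plane} (hP : P ∈ convexPolygons)
    (hang : AnglesAtLeast (Real.pi / 4) P) (x : Plane) : ¬ IsCritical 2 standardBasis P x := by
  intro h
  obtain ⟨hcomp, hconv, hint⟩ := convexPolygons_subset hP
  have hx := hang x (h.mem_extremePoints le_rfl hcomp.isClosed hconv hint)
  have hlt := fun y hy z hz hyx hzx =>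
    h.abs_cross_lt_dot hconv hint (y := y) (z := z) hy hz hyx hzx
  obtain ⟨⟨F, rfl⟩, -⟩ := hP
  have hF : ∀ f ∈ F, f ∈ convexHull ℝ (F : Set Plane) := fun f hf => subset_convexHull ℝ _ hf
  obtain ⟨κ, hκ0, hκ1, hκ⟩ := exists_ratio_lt_one (F := F) (x := x)
    fun f hf g hg hfx hgx => hlt f (hF f hf) g (hF g hg) hfx hgx
  -- This is the cosine of the angle with tangent `κ`.
  set m := 1 / Real.sqrt (1 + κ ^ 2) with hm
  have hsq : Real.sqrt (1 + κ ^ 2) < Real.sqrt 2 := Real.sqrt_lt_sqrt (by positivity) (by nlinarith)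
  have hsqpos : 0 < Real.sqrt (1 + κ ^ 2) := Real.sqrt_pos.2 (by positivity)
  have hθ : Real.arccos m < Real.pi / 4 := by
    have h1 : Real.arccos (Real.sqrt 2 / 2) = Real.pi / 4 := by
      rw [← Real.cos_pi_div_four]
      exact Real.arccos_cos (by positivity) (by linarith [Real.pi_pos])
    rw [← h1]
    have hs2 : Real.sqrt 2 ^ 2 = 2 := Real.sq_sqrt (by norm_num)
    have hs20 := Real.sqrt_nonneg 2
    refine Real.strictAntiOn_arccos ⟨by linarith [hs20], by nlinarith⟩ ⟨?_, ?_⟩ ?_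
    · have : 0 ≤ m := by positivity
      linarith
    · rw [hm, div_le_one hsqpos, Real.one_le_sqrt]
      nlinarith
    · rw [hm, lt_div_iff₀ hsqpos]
      nlinarith
  refine absurd (hx.trans (Real.sSup_le ?_ (Real.arccos_nonneg m))) (not_le.2 hθ)
  rintro _ ⟨y, hy, z, hz, hyx, hzx, rfl⟩
  refine Real.arccos_le_arccos ?_
  have hd := hlt y hy z hz hyx hzx
  have hc := abs_cross_le_of_generators hκ hy hz
  have hsub : ∀ w : Plane, w -ᵥ x = w - x := fun w => rfl
  rw [hsub, hsub, inner_eq_dot]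
  have hn := norm_sq_mul_norm_sq (y - x) (z - x)
  have hy0 : 0 < ‖y - x‖ := norm_pos_iff.2 (sub_ne_zero.2 hyx)
  have hz0 : 0 < ‖z - x‖ := norm_pos_iff.2 (sub_ne_zero.2 hzx)
  have hd0 := (abs_nonneg _).trans_lt hd
  rw [hm, div_le_div_iff₀ hsqpos (mul_pos hy0 hz0), one_mul]
  refine le_of_sq_le_sq ?_ (mul_pos hd0 hsqpos).le
  rw [mul_pow, mul_pow, hn, Real.sq_sqrt (by positivity)]
  have : cross (y - x) (z - x) ^ 2 ≤ (κ * dot (y - x) (z - x)) ^ 2 := by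
    rw [← sq_abs (cross _ _)]
    exact pow_le_pow_left₀ (abs_nonneg _) hc 2
  linarith

end

end LocalEuler

theorem mainTheorem5 :
    (∀ (ξ : Module.Basis (Fin 2) ℝ LocalEuler.Plane) (n : ℕ), 0 < n →
      ∀ K ∈ LocalEuler.convexBodies, (∀ x, ¬ LocalEuler.IsCritical n ξ K x) →
        ∃ δ : ℝ, 0 < δ ∧ ∀ a : ℝ, 0 < a → a < δ → ∀ c : LocalEuler.Plane,
          LocalEuler.localEuler n ξ a c K = 1) ∧
    (∀ ξ : Module.Basis (Fin 2) ℝ LocalEuler.Plane,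
      ∃ ψ : ℕ → ℝ, (∀ n, 0 < ψ n) ∧ (∀ n, 2 ≤ n → ψ n < Real.pi) ∧
        Tendsto ψ atTop (𝓝 0) ∧
        ∀ n : ℕ, 0 < n →
          LocalEuler.MultigridConvergent (LocalEuler.localEuler n ξ) LocalEuler.eulerChar
            {K | K ∈ LocalEuler.convexBodies ∧ LocalEuler.AnglesAtLeast (ψ n) K}) ∧
    LocalEuler.MultigridConvergent (LocalEuler.localEuler 2 LocalEuler.standardBasis)
      LocalEuler.eulerChar
      {P | P ∈ LocalEuler.convexPolygons ∧ LocalEuler.AnglesAtLeast (Real.pi / 4) P} :=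
  ⟨fun ξ _ hn _ hK hcrit => LocalEuler.localEuler_eq_one ξ hn hK hcrit,
    LocalEuler.exists_angle_thresholds,
    LocalEuler.multigridConvergent_of_not_isCritical _ two_pos fun _ hP =>
      ⟨LocalEuler.convexPolygons_subset hP.1, LocalEuler.not_isCritical_of_polygon hP.1 hP.2⟩⟩
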